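/- Let $M$ be a smooth ($C^\infty$, Hausdorff, second countable, without boundary) manifold of dimension $6$, and let $\omega$ be a smooth real $3$-form on $M$ of type 2, that is, for every $x\in M$ $$\Delta(\omega_x):=\{v\in T_xM : (\iota_v\omega_x)\wedge(\iota_v\omega_x)=0\}=\{0\}.$$ Let $J$ be a smooth almost complex structure on $M$ (a smooth field of endomorphisms of $TM$ with $J^2=-\mathrm{Id}$) with respect to which $\omega$ is pure, that is, for all vector fields $X_1,X_2,X_3$ on $M$, $$\omega(JX_1,X_2,X_3)=\omega(X_1,JX_2,X_3)=\omega(X_1,X_2,JX_3).$$ Then there exists a smooth symmetric (torsion-free) linear connection $\nabla$ on $M$ with $\nabla\omega=0$ if and only if both of the following conditions hold: (i) $d\omega=0$; (ii) the almost complex structure $J$ is integrable, i.e. its Nijenhuis tensor $N_J(X,Y)=[JX,JY]-J[JX,Y]-J[X,JY]-[X,Y]$ vanishes for all smooth vector fields $X,Y$. -/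

import Mathlib

open scoped Manifold ContDiff TensorProduct
open Bundle

noncomputable section

/-! ### Linear algebra of 3-forms -/

/-- The exterior product `a ∧ b` of two real-valued alternating forms (sum over shuffles). -/
def altWedge {V : Type*} [AddCommGroup V] [Module ℝ V] {p q : ℕ}
    (a : V [⋀^Fin p]→ₗ[ℝ] ℝ) (b : V [⋀^Fin q]→ₗ[ℝ] ℝ) : V [⋀^Fin p ⊕ Fin q]→ₗ[ℝ] ℝ :=
  (LinearMap.mul' ℝ ℝ).compAlternatingMap (a.domCoprod b)

/-- The set `Δ(w) = {v ; (ι_v w) ∧ (ι_v w) = 0}` of a 3-form `w`, where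
`ι_v w = w(v, ·, ·)`. -/
def formDelta {V : Type*} [AddCommGroup V] [Module ℝ V] [TopologicalSpace V]
    (w : V [⋀^Fin 3]→L[ℝ] ℝ) : Set V :=
  {v | altWedge (w.toAlternatingMap.curryLeft v) (w.toAlternatingMap.curryLeft v) = 0}

/-- A 3-form `w` is pure with respect to the endomorphism `J`:
`w(J v₁, v₂, v₃) = w(v₁, J v₂, v₃) = w(v₁, v₂, J v₃)`. -/
def IsPureForm {V : Type*} [AddCommGroup V] [Module ℝ V] [TopologicalSpace V]
    (w : V [⋀^Fin 3]→L[ℝ] ℝ) (J : V →L[ℝ] V) : Prop :=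
  ∀ v₁ v₂ v₃ : V, w ![J v₁, v₂, v₃] = w ![v₁, J v₂, v₃] ∧ w ![v₁, J v₂, v₃] = w ![v₁, v₂, J v₃]

/-! ### Tensor fields on 6-manifolds -/

/-- The model space `ℝ⁶`. -/
abbrev R6 : Type := EuclideanSpace ℝ (Fin 6)

section Manifold

variable {M : Type*} [TopologicalSpace M] [ChartedSpace R6 M]

/-- A (not necessarily smooth) field of alternating `k`-forms on the tangent spaces of `M`. -/
abbrev FormField (M : Type*) [TopologicalSpace M] [ChartedSpace R6 M] (k : ℕ) : Type _ :=
  ∀ x : M, TangentSpace (𝓡 6) x [⋀^Fin k]→L[ℝ] ℝ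

/-- A (not necessarily smooth) vector field on `M`. -/
abbrev VField (M : Type*) [TopologicalSpace M] [ChartedSpace R6 M] : Type _ :=
  ∀ x : M, TangentSpace (𝓡 6) x

/-- A (not necessarily smooth) field of endomorphisms of the tangent spaces of `M`. -/
abbrev EndField (M : Type*) [TopologicalSpace M] [ChartedSpace R6 M] : Type _ :=
  ∀ x : M, TangentSpace (𝓡 6) x →L[ℝ] TangentSpace (𝓡 6) x

/-- The coordinate expression of a form in the preferred chart at `x₀`: the pullback of the form
under the inverse of the chart (meaningful on the target of the chart). -/
def chartForm {k : ℕ} (Ω : FormField M k) (x₀ : M) (y : R6) : R6 [⋀^Fin k]→L[ℝ] ℝ :=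
  (Ω ((extChartAt (𝓡 6) x₀).symm y)).compContinuousLinearMap
    (mfderiv 𝓘(ℝ, R6) (𝓡 6) (extChartAt (𝓡 6) x₀).symm y : R6 →L[ℝ] _)

/-- The form is smooth: all its coordinate expressions are. -/
def IsSmoothForm {k : ℕ} (Ω : FormField M k) : Prop :=
  ∀ x₀ : M, ContDiffOn ℝ ∞ (chartForm Ω x₀) (extChartAt (𝓡 6) x₀).target

/-- The exterior derivative of a form on `M`, computed at `x` in the preferred chart at `x`. -/
def mextDeriv {k : ℕ} (Ω : FormField M k) : FormField M (k + 1) := fun x =>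
  (extDeriv (chartForm Ω x) (extChartAt (𝓡 6) x x)).compContinuousLinearMap
    (mfderiv (𝓡 6) 𝓘(ℝ, R6) (extChartAt (𝓡 6) x) x : _ →L[ℝ] R6)

/-- The vector field is smooth. -/
def IsSmoothVField [IsManifold (𝓡 6) ∞ M] (X : VField M) : Prop :=
  ContMDiff (𝓡 6) (𝓡 6).tangent ∞ (fun x => (⟨x, X x⟩ : TangentBundle (𝓡 6) M))

/-- `J` is an almost complex structure on `M`: a smooth section of `End(TM)` with `J² = -1`. -/
structure IsAlmostComplexStructure [IsManifold (𝓡 6) ∞ M] (J : EndField M) : Prop where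
  smooth : ContMDiff (𝓡 6) ((𝓡 6).prod 𝓘(ℝ, R6 →L[ℝ] R6)) ∞
    (fun x => (⟨x, J x⟩ : TotalSpace (R6 →L[ℝ] R6)
      (fun x : M => TangentSpace (𝓡 6) x →L[ℝ] TangentSpace (𝓡 6) x)))
  sq : ∀ (x : M) (v : TangentSpace (𝓡 6) x), J x (J x v) = -v

/-- The Nijenhuis tensor `N_J(X, Y) = [JX, JY] - J[JX, Y] - J[X, JY] - [X, Y]`. -/
def nijenhuis (J : EndField M) (X Y : VField M) : VField M := fun x =>
  VectorField.mlieBracket (𝓡 6) (fun z => J z (X z)) (fun z => J z (Y z)) x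
    - J x (VectorField.mlieBracket (𝓡 6) (fun z => J z (X z)) Y x)
    - J x (VectorField.mlieBracket (𝓡 6) X (fun z => J z (Y z)) x)
    - VectorField.mlieBracket (𝓡 6) X Y x

/-- The almost complex structure `J` is integrable: its Nijenhuis tensor vanishes. -/
def IsIntegrableACS [IsManifold (𝓡 6) ∞ M] (J : EndField M) : Prop :=
  ∀ X Y : VField M, IsSmoothVField X → IsSmoothVField Y → ∀ x : M, nijenhuis J X Y x = 0

/-- A linear connection on `M`, i.e. a covariant derivative on `TM` (smoothness is the separate
condition `CovariantDerivative.ContMDiffCovariantDerivative`); `cov Y x (X x)` is `∇_X Y` at `x`. -/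
abbrev LinearConnection (M : Type*) [TopologicalSpace M] [ChartedSpace R6 M]
    [IsManifold (𝓡 6) ∞ M] : Type _ :=
  CovariantDerivative (𝓡 6) R6 (fun x : M => TangentSpace (𝓡 6) x)

/-- The covariant derivative of a 3-form at `x` in the direction `v`:
`(∇_v Ω)(X₁, X₂, X₃) = v(Ω(X₁, X₂, X₃)) - Ω(∇_v X₁, X₂, X₃) - Ω(X₁, ∇_v X₂, X₃)
- Ω(X₁, X₂, ∇_v X₃)`. -/
def covDerivForm [IsManifold (𝓡 6) ∞ M] (cov : LinearConnection M) (Ω : FormField M 3)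
    (X₁ X₂ X₃ : VField M) (x : M) (v : TangentSpace (𝓡 6) x) : ℝ :=
  mvfderiv (𝓡 6) (fun z => Ω z ![X₁ z, X₂ z, X₃ z]) x v
    - Ω x ![cov X₁ x v, X₂ x, X₃ x]
    - Ω x ![X₁ x, cov X₂ x v, X₃ x]
    - Ω x ![X₁ x, X₂ x, cov X₃ x v]

/-- The 3-form is parallel, `∇Ω = 0`. -/
def IsParallelForm [IsManifold (𝓡 6) ∞ M] (cov : LinearConnection M) (Ω : FormField M 3) : Prop :=
  ∀ X₁ X₂ X₃ : VField M, IsSmoothVField X₁ → IsSmoothVField X₂ → IsSmoothVField X₃ →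
    ∀ (x : M) (v : TangentSpace (𝓡 6) x), covDerivForm cov Ω X₁ X₂ X₃ x v = 0

end Manifold

end

noncomputable section

/-! ### Trilinear alternating functions -/

/-! Type 2 enters only through non-degeneracy: a vector `v` with `ι_v ω = 0` is zero
(`eq_zero_of_formDelta`).

Sufficiency is local. In a chart, correct the flat connection by a term `G` built from `J` and its
first derivatives. The result preserves `J`, and its torsion is a multiple of the Nijenhuis tensor,
so it is symmetric when `J` is integrable (`acsCorrection_map`, `acsCorrection_symm`). Since this
connection preserves `J`, the derivative `β_v` of `ω` along `v` is again a pure 3-form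
(`derivCorrection_pure`). A pure 3-form is the real part of a complex-trilinear alternating form. In
complex dimension 3 these form a complex line, so `β_v(x,y,z) = ω(c(v,x),y,z)` with `c(v,x) = a(v) x
+ b(v) J x` and real one-forms `a`, `b` (`IsAltTrilinear.eq_comp_of_pure`). Adding `(1/4)(c(v,x) +
c(x,v))` to `G` keeps the symmetry. Summed over the three slots, `c(v,·)` contributes `3 β_v`, and
`c(·,v)` contributes one more `β_v` because `dω = 0`; the quarter of the total cancels the defect
(`deriv_eq_of_closed`). Being a connection, symmetric and compatible with `ω` are affine conditions,
so a partition of unity glues the local solutions (`exists_parallel_connection`).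

Necessity: for a symmetric connection `dω` is the alternation of `∇ω`. Purity and non-degeneracy
turn `∇ω = 0` into `∇J = 0` (`cov_end_eq_of_parallel`), and for a symmetric connection `∇J = 0`
forces `N_J = 0`. -/

/-- A real-valued function of three vectors which is trilinear and alternating. -/
structure IsAltTrilinear {V : Type*} [AddCommGroup V] [Module ℝ V] (f : V → V → V → ℝ) : Prop where
  add_left : ∀ x x' y z, f (x + x') y z = f x y z + f x' y z
  smul_left : ∀ (c : ℝ) x y z, f (c • x) y z = c * f x y z
  swap_left : ∀ x y z, f y x z = -f x y z
  swap_right : ∀ x y z, f x z y = -f x y z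

namespace IsAltTrilinear

variable {V : Type*} [AddCommGroup V] [Module ℝ V] {f g : V → V → V → ℝ} {J : V → V}

lemma add_mid (hf : IsAltTrilinear f) (x y y' z : V) :
    f x (y + y') z = f x y z + f x y' z := by
  rw [hf.swap_left, hf.add_left, hf.swap_left x y, hf.swap_left x y']; ring

lemma smul_mid (hf : IsAltTrilinear f) (c : ℝ) (x y z : V) : f x (c • y) z = c * f x y z := by
  rw [hf.swap_left, hf.smul_left, hf.swap_left x y]; ring

lemma add_right (hf : IsAltTrilinear f) (x y z z' : V) :
    f x y (z + z') = f x y z + f x y z' := by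
  rw [hf.swap_right, hf.add_mid, hf.swap_right x y z, hf.swap_right x y z']; ring

lemma smul_right (hf : IsAltTrilinear f) (c : ℝ) (x y z : V) : f x y (c • z) = c * f x y z := by
  rw [hf.swap_right, hf.smul_mid, hf.swap_right x y z]; ring

lemma self_left (hf : IsAltTrilinear f) (x z : V) : f x x z = 0 := by
  linarith [hf.swap_left x x z]

lemma self_right (hf : IsAltTrilinear f) (x y : V) : f x y y = 0 := by
  linarith [hf.swap_right x y y]

lemma self_outer (hf : IsAltTrilinear f) (x y : V) : f x y x = 0 := by
  rw [hf.swap_left, hf.self_right, neg_zero]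

/-- Cyclic permutations of three arguments are even, so purity in the first two slots rotates to the
last two. Hence only one of the two purity equations has to be carried along. -/
lemma pure_right (hf : IsAltTrilinear f) (h : ∀ x y z, f (J x) y z = f x (J y) z) (x y z : V) :
    f x (J y) z = f x y (J z) := by
  have h1 : f x y (J z) = f y (J z) x := by
    rw [hf.swap_left y x, hf.swap_right y (J z) x]; ring
  have h2 : f x (J y) z = f (J y) z x := by
    rw [hf.swap_left (J y) x, hf.swap_right (J y) z x]; ring
  rw [h1, h2, h]

/-- A trilinear alternating function which is pure for a complex structure is the real part of a
complex trilinear alternating map. -/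
lemma exists_complex_alternating [Module ℂ V] (hf : IsAltTrilinear f)
    (hJ : ∀ (c : ℂ) (x : V), c • x = c.re • x + c.im • J x) (hJJ : ∀ x, J (J x) = -x)
    (h : ∀ x y z, f (J x) y z = f x (J y) z) :
    ∃ F : V [⋀^Fin 3]→ₗ[ℂ] ℂ, ∀ m, F m = f (m 0) (m 1) (m 2) - Complex.I * f (J (m 0)) (m 1) (m 2) := by
  have hneg : ∀ x y z, f (-x) y z = -f x y z := fun x y z ↦ by
    simpa using hf.smul_left (-1) x y z
  have Jadd : ∀ x x', J (x + x') = J x + J x' := fun x x' ↦ by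
    have h1 := hJ Complex.I (x + x')
    rw [smul_add, hJ, hJ] at h1
    simpa using h1.symm
  have Jsmul : ∀ (a b : ℝ) x, J (a • x + b • J x) = a • J x - b • x := fun a b x ↦ by
    have h1 := hJ Complex.I ((⟨a, b⟩ : ℂ) • x)
    rw [← mul_smul, hJ, hJ] at h1
    simp at h1
    rw [← h1]; abel
  have h2 := hf.pure_right h
  -- The imaginary part is forced: complex linearity requires `F (J x) y z = I * F x y z`, and
  -- comparing imaginary parts gives `Im F x y z = -f (J x) y z`.
  refine ⟨{ toFun := fun m ↦ f (m 0) (m 1) (m 2) - Complex.I * f (J (m 0)) (m 1) (m 2)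
            map_update_add' := ?_
            map_update_smul' := ?_
            map_eq_zero_of_eq' := ?_ }, fun m ↦ rfl⟩
  · intro inst m i x y
    obtain rfl : inst = instDecidableEqFin 3 := Subsingleton.elim _ _
    fin_cases i <;>
      simp [Function.update, Jadd, hf.add_left, hf.add_mid, hf.add_right] <;> ring
  · intro inst m i c x
    obtain rfl : inst = instDecidableEqFin 3 := Subsingleton.elim _ _
    obtain ⟨a, b⟩ := c
    fin_cases i
    · simp [Function.update, hJ, Jsmul, hf.add_left, hf.smul_left, sub_eq_add_neg, ← neg_smul]
      apply Complex.ext <;> simp <;> ring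
    · simp [Function.update, hJ, hf.add_mid, hf.smul_mid]
      simp only [← h, hJJ, hneg]
      apply Complex.ext <;> simp <;> ring
    · simp [Function.update, hJ, hf.add_right, hf.smul_right]
      simp only [← h2, ← h, hJJ, hneg]
      apply Complex.ext <;> simp <;> ring
  · intro m i j hij hne
    fin_cases i <;> fin_cases j <;> simp at hne hij <;>
      simp only [hij, h, hf.self_left, hf.self_right, hf.self_outer]
    all_goals simp [h2, hf.self_left]
    all_goals simp [← h2, ← h, hf.self_right]

/-- On a real vector space of dimension 6 with a complex structure, the pure alternating trilinear
functions form a space of complex dimension one. -/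
lemma pure_proportional (hV : Module.finrank ℝ V = 6) {J : V →ₗ[ℝ] V} (hJJ : ∀ x, J (J x) = -x)
    (hf : IsAltTrilinear f) (hg : IsAltTrilinear g)
    (hfJ : ∀ x y z, f (J x) y z = f x (J y) z) (hgJ : ∀ x y z, g (J x) y z = g x (J y) z)
    (u v w x y z : V) :
    ((f u v w : ℂ) - Complex.I * f (J u) v w) * (g x y z - Complex.I * g (J x) y z) =
      (g u v w - Complex.I * g (J u) v w) * (f x y z - Complex.I * f (J x) y z) := by
  have hI : (J : Module.End ℝ V) * J = -1 := by ext x; simp [hJJ]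
  -- `J` makes `V` a complex space of dimension 3, where 3-forms have top degree and are multiples
  -- of one determinant. The cross-multiplied identity then needs no nonvanishing hypothesis.
  let _ : Module ℂ V := Module.compHom V (Complex.lift ⟨J, hI⟩ : ℂ →ₐ[ℝ] Module.End ℝ V).toRingHom
  have hsmul : ∀ (c : ℂ) (x : V), c • x = c.re • x + c.im • J x := fun c x ↦ by
    change (Complex.lift ⟨J, hI⟩ c : Module.End ℝ V) x = _
    simp [Complex.liftAux_apply]
  have : IsScalarTower ℝ ℂ V := ⟨fun r c x ↦ by
    rw [hsmul, hsmul]; simp [mul_smul]⟩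
  have : FiniteDimensional ℝ V := Module.finite_of_finrank_pos (by omega)
  have : FiniteDimensional ℂ V := Module.Finite.of_restrictScalars_finite ℝ ℂ V
  have hdim : Module.finrank ℂ V = 3 := by
    have := Module.finrank_mul_finrank ℝ ℂ V
    rw [Complex.finrank_real_complex, hV] at this
    omega
  let b := Module.finBasisOfFinrankEq ℂ V hdim
  obtain ⟨F, hF⟩ := hf.exists_complex_alternating hsmul hJJ hfJ
  obtain ⟨G, hG⟩ := hg.exists_complex_alternating hsmul hJJ hgJ
  have e1 := hF ![u, v, w]
  have e2 := hG ![u, v, w]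
  have e3 := hF ![x, y, z]
  have e4 := hG ![x, y, z]
  simp only [Matrix.cons_val] at e1 e2 e3 e4
  rw [← e1, ← e2, ← e3, ← e4, F.eq_smul_basis_det b, G.eq_smul_basis_det b]
  simp only [AlternatingMap.smul_apply, smul_eq_mul]
  ring

/-- A pure alternating trilinear function `g` is obtained from a given one `f` by inserting
`a + b J` in the first argument, with explicit coefficients. -/
lemma eq_comp_of_pure (hV : Module.finrank ℝ V = 6) {J : V →ₗ[ℝ] V} (hJJ : ∀ x, J (J x) = -x)
    (hf : IsAltTrilinear f) (hg : IsAltTrilinear g)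
    (hfJ : ∀ x y z, f (J x) y z = f x (J y) z) (hgJ : ∀ x y z, g (J x) y z = g x (J y) z)
    {u v w : V} (h0 : f u v w ≠ 0) (x y z : V) :
    g x y z = f (((g u v w * f u v w + g (J u) v w * f (J u) v w) /
        (f u v w ^ 2 + f (J u) v w ^ 2)) • x +
      ((g u v w * f (J u) v w - g (J u) v w * f u v w) /
        (f u v w ^ 2 + f (J u) v w ^ 2)) • J x) y z := by
  -- With `F`, `G` the complex forms attached to `f`, `g`, the two coefficients are the real and
  -- imaginary parts of `G(u,v,w) / F(u,v,w)`. Their explicit form makes smooth dependence on a base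
  -- point visible.
  have key := pure_proportional hV hJJ hf hg hfJ hgJ u v w x y z
  have hre := congrArg Complex.re key
  have him := congrArg Complex.im key
  simp at hre him
  have hpos : f u v w ^ 2 + f (J u) v w ^ 2 ≠ 0 := by positivity
  rw [hf.add_left, hf.smul_left, hf.smul_left]
  field_simp
  linear_combination (f u v w) * hre - f (J u) v w * him

end IsAltTrilinear

/-! ### Connections adapted to a pure 3-form: pointwise algebra -/

section Pointwise

variable {V : Type*} [AddCommGroup V] [Module ℝ V]

/-- The correction term turning the flat connection into one preserving the almost complex
structure `J` with derivative `A`. -/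
noncomputable def acsCorrection (J : V →ₗ[ℝ] V) (A : V →ₗ[ℝ] V →ₗ[ℝ] V) : V →ₗ[ℝ] V →ₗ[ℝ] V :=
  (-(1 / 4 : ℝ)) • ((A.compl₁₂ J LinearMap.id).flip + (A.compr₂ J).flip + (2 : ℝ) • A.compr₂ J)

lemma acsCorrection_apply (J : V →ₗ[ℝ] V) (A : V →ₗ[ℝ] V →ₗ[ℝ] V) (v x : V) :
    acsCorrection J A v x =
      (-(1 / 4 : ℝ)) • (A (J x) v + J (A x v) + (2 : ℝ) • J (A v x)) := by
  simp [acsCorrection]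

variable {J : V →ₗ[ℝ] V} {A : V →ₗ[ℝ] V →ₗ[ℝ] V}

/-- This says that the corrected connection preserves `J`. The summand `-(1/2) J (A v x)` alone
achieves it; the other two summands together commute with `J` in `x`, because `J² = -1`. -/
lemma acsCorrection_map (hJJ : ∀ x, J (J x) = -x) (hA : ∀ v x, A v (J x) = -J (A v x)) (v x : V) :
    acsCorrection J A v (J x) = J (acsCorrection J A v x) - A v x := by
  simp only [acsCorrection_apply, hJJ, hA, map_neg, map_smul, map_add, LinearMap.neg_apply]
  module

/-- The antisymmetric part of the correction is exactly one quarter of the Nijenhuis expression in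
`hN`, which explains the factor `1 / 4`. -/
lemma acsCorrection_symm
    (hN : ∀ u v, A (J u) v - A (J v) u + J (A v u) - J (A u v) = 0) (u v : V) :
    acsCorrection J A u v = acsCorrection J A v u := by
  have h := hN u v
  simp only [acsCorrection_apply]
  rw [← sub_eq_zero]
  trans (1 / 4 : ℝ) • (A (J u) v - A (J v) u + J (A v u) - J (A u v))
  · module
  · rw [h, smul_zero]

variable {w : V → V → V → ℝ}

/-- Change of the derivative `D` of a trilinear function `w` when the flat connection is modified
by the endomorphism-valued one-form `G`. -/
def derivCorrection (w : V → V → V → ℝ) (D : V → V → V → V → ℝ) (G : V →ₗ[ℝ] V →ₗ[ℝ] V)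
    (v x y z : V) : ℝ :=
  D v x y z - w (G v x) y z - w x (G v y) z - w x y (G v z)

lemma isAltTrilinear_derivCorrection (hw : IsAltTrilinear w) {D : V → V → V → V → ℝ}
    (hD : ∀ v, IsAltTrilinear (D v)) (G : V →ₗ[ℝ] V →ₗ[ℝ] V) (v : V) :
    IsAltTrilinear (derivCorrection w D G v) where
  add_left x x' y z := by
    simp only [derivCorrection, (hD v).add_left, hw.add_left, map_add]; ring
  smul_left c x y z := by
    simp only [derivCorrection, (hD v).smul_left, hw.smul_left, map_smul]; ring
  swap_left x y z := by
    simp only [derivCorrection]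
    rw [(hD v).swap_left x, hw.swap_left (G v y) x, hw.swap_left y (G v x),
      hw.swap_left y x]
    ring
  swap_right x y z := by
    simp only [derivCorrection]
    rw [(hD v).swap_right x, hw.swap_right x (G v y) z, hw.swap_right x y (G v z),
      hw.swap_right (G v x) y z]
    ring

/-- A connection preserving `J` differentiates pure forms to pure forms: `hDJ` is the purity
equation differentiated, and its `A`-terms are absorbed by `acsCorrection_map`. -/
lemma derivCorrection_pure (hw : IsAltTrilinear w) {D : V → V → V → V → ℝ}
    (hJJ : ∀ x, J (J x) = -x) (hA : ∀ v x, A v (J x) = -J (A v x))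
    (hwJ : ∀ x y z, w (J x) y z = w x (J y) z)
    (hDJ : ∀ v x y z, D v (J x) y z + w (A v x) y z = D v x (J y) z + w x (A v y) z)
    (v x y z : V) :
    derivCorrection w D (acsCorrection J A) v (J x) y z =
      derivCorrection w D (acsCorrection J A) v x (J y) z := by
  have hsub : ∀ x x' y z, w (x - x') y z = w x y z - w x' y z := fun x x' y z ↦ by
    rw [sub_eq_add_neg, hw.add_left, ← neg_one_smul ℝ x', hw.smul_left]; ring
  have hsub' : ∀ x y y' z, w x (y - y') z = w x y z - w x y' z := fun x y y' z ↦ by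
    rw [sub_eq_add_neg, hw.add_mid, ← neg_one_smul ℝ y', hw.smul_mid]; ring
  simp only [derivCorrection, acsCorrection_map hJJ hA, hsub, hsub', hwJ]
  linear_combination hDJ v x y z

/-- Closedness of the form provides the symmetric correction making it parallel. -/
lemma deriv_eq_of_closed (hw : IsAltTrilinear w) {D : V → V → V → V → ℝ}
    {G : V →ₗ[ℝ] V →ₗ[ℝ] V} (hG : ∀ u v, G u v = G v u)
    (hclosed : ∀ v x y z, D v x y z - D x v y z + D y v x z - D z v x y = 0)
    {c : V → V → V} (hc : ∀ v x y z, derivCorrection w D G v x y z = w (c v x) y z)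
    (hb : ∀ v, IsAltTrilinear (derivCorrection w D G v))
    (v x y z : V) :
    D v x y z = w (G v x + (1 / 4 : ℝ) • (c v x + c x v)) y z +
      w x (G v y + (1 / 4 : ℝ) • (c v y + c y v)) z +
      w x y (G v z + (1 / 4 : ℝ) • (c v z + c z v)) := by
  have mid : ∀ v x y z, w x (c v y) z = derivCorrection w D G v x y z := fun v x y z ↦ by
    rw [hw.swap_left, ← hc, (hb v).swap_left]; ring
  have right : ∀ v x y z, w x y (c v z) = derivCorrection w D G v x y z := fun v x y z ↦ by
    rw [hw.swap_right, mid, (hb v).swap_right]; ring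
  -- All `G`-terms cancel in the alternation since `G` is symmetric, so closedness passes from `D`
  -- to the corrected derivative.
  have hB : derivCorrection w D G v x y z - derivCorrection w D G x v y z +
      derivCorrection w D G y v x z - derivCorrection w D G z v x y = 0 := by
    have h4 := hclosed v x y z
    simp only [derivCorrection]
    rw [hG x v, hG y v, hG z v, hG y x, hG z x, hG z y]
    rw [hw.swap_left (G v y) x, hw.swap_right x (G v z) y, hw.swap_left (G v z) x,
      hw.swap_right v (G x z) y]
    linear_combination h4
  -- The terms `c v ·` give the corrected derivative three times and the terms `c · v` give it once
  -- more by `hB`; four copies against the factor `1 / 4`.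
  simp only [hw.add_left, hw.smul_left, hw.add_mid, hw.smul_mid, hw.add_right, hw.smul_right,
    ← hc, mid, right]
  rw [(hb y).swap_left v x, (hb z).swap_right x v, (hb z).swap_left v x]
  have hv : D v x y z = derivCorrection w D G v x y z + w (G v x) y z + w x (G v y) z +
      w x y (G v z) := by simp only [derivCorrection]; ring
  linear_combination hv + (1 / 4) * hB

end Pointwise

/-! ### Local existence of the connection in a vector space -/

section Local

variable {E : Type*} [NormedAddCommGroup E] [NormedSpace ℝ E]

noncomputable instance instNormedAddCommGroupBilinear :
    NormedAddCommGroup (E →L[ℝ] E →L[ℝ] ℝ) :=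
  ContinuousLinearMap.toNormedAddCommGroup

noncomputable instance instNormedSpaceBilinear : NormedSpace ℝ (E →L[ℝ] E →L[ℝ] ℝ) :=
  ContinuousLinearMap.toNormedSpace

noncomputable instance instNormedAddCommGroupTrilinear :
    NormedAddCommGroup (E →L[ℝ] E →L[ℝ] E →L[ℝ] ℝ) :=
  ContinuousLinearMap.toNormedAddCommGroup

noncomputable instance instNormedSpaceTrilinear : NormedSpace ℝ (E →L[ℝ] E →L[ℝ] E →L[ℝ] ℝ) :=
  ContinuousLinearMap.toNormedSpace

lemma fderiv_apply₃ {W : E → E →L[ℝ] E →L[ℝ] E →L[ℝ] ℝ} {p : E} (hW : DifferentiableAt ℝ W p)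
    (v x y z : E) : fderiv ℝ (fun q ↦ W q x y z) p v = fderiv ℝ W p v x y z := by
  have h1 := hW.hasFDerivAt.clm_apply (hasFDerivAt_const x p)
  have h2 := h1.clm_apply (hasFDerivAt_const y p)
  have h3 := h2.clm_apply (hasFDerivAt_const z p)
  rw [h3.fderiv]; simp

set_option synthInstance.maxHeartbeats 200000 in
/-- Local existence of a symmetric connection preserving a closed pure 3-form with respect to an
integrable almost complex structure, in dimension 6. -/
theorem exists_local_christoffel [FiniteDimensional ℝ E] (hE : Module.finrank ℝ E = 6)
    {U : Set E} (hU : IsOpen U)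
    {W : E → E →L[ℝ] E →L[ℝ] E →L[ℝ] ℝ} {J : E → E →L[ℝ] E}
    (hW : ContDiffOn ℝ ∞ W U) (hJ : ContDiffOn ℝ ∞ J U)
    (halt : ∀ p ∈ U, IsAltTrilinear (fun x y z ↦ W p x y z))
    (hJJ : ∀ p ∈ U, ∀ x, J p (J p x) = -x)
    (hpure : ∀ p ∈ U, ∀ x y z, W p (J p x) y z = W p x (J p y) z)
    (hclosed : ∀ p ∈ U, ∀ v x y z, fderiv ℝ W p v x y z - fderiv ℝ W p x v y z
      + fderiv ℝ W p y v x z - fderiv ℝ W p z v x y = 0)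
    (hN : ∀ p ∈ U, ∀ u v, fderiv ℝ J p (J p u) v - fderiv ℝ J p (J p v) u
      + J p (fderiv ℝ J p v u) - J p (fderiv ℝ J p u v) = 0)
    {p₀ : E} (hp₀ : p₀ ∈ U) {u₁ u₂ u₃ : E} (h0 : W p₀ u₁ u₂ u₃ ≠ 0) :
    ∃ V, IsOpen V ∧ p₀ ∈ V ∧ V ⊆ U ∧ ∃ Γ : E → E →L[ℝ] E →L[ℝ] E, ContDiffOn ℝ ∞ Γ V ∧
      ∀ p ∈ V, (∀ u v, Γ p u v = Γ p v u) ∧ ∀ v x y z, fderiv ℝ W p v x y z =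
        W p (Γ p v x) y z + W p x (Γ p v y) z + W p x y (Γ p v z) := by
  let A : E → E →ₗ[ℝ] E →ₗ[ℝ] E := fun p ↦
    (ContinuousLinearMap.coeLM ℝ).comp (fderiv ℝ J p).toLinearMap
  have hAapp : ∀ p v x, A p v x = fderiv ℝ J p v x := fun p v x ↦ rfl
  let G : E → E →ₗ[ℝ] E →ₗ[ℝ] E := fun p ↦ acsCorrection (J p).toLinearMap (A p)
  let D : E → E → E → E → E → ℝ := fun p v x y z ↦ fderiv ℝ W p v x y z
  let w : E → E → E → E → ℝ := fun p x y z ↦ W p x y z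
  let β : E → E → E → E → E → ℝ := fun p ↦ derivCorrection (w p) (D p) (G p)
  -- `a` and `b` are the coefficients of `eq_comp_of_pure`, evaluated on the fixed triple `u₁, u₂,
  -- u₃` for every `p`.
  let a : E → E → ℝ := fun p v ↦
    (β p v u₁ u₂ u₃ * w p u₁ u₂ u₃ + β p v (J p u₁) u₂ u₃ * w p (J p u₁) u₂ u₃) /
        (w p u₁ u₂ u₃ ^ 2 + w p (J p u₁) u₂ u₃ ^ 2)
  let b : E → E → ℝ := fun p v ↦
    (β p v u₁ u₂ u₃ * w p (J p u₁) u₂ u₃ - β p v (J p u₁) u₂ u₃ * w p u₁ u₂ u₃) /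
        (w p u₁ u₂ u₃ ^ 2 + w p (J p u₁) u₂ u₃ ^ 2)
  have hβlin : ∀ p x y z, ∀ (c : ℝ) v v', β p (c • v + v') x y z = c * β p v x y z + β p v' x y z := by
    intro p x y z c v v'
    simp only [β, derivCorrection, D, w, map_add, map_smul, _root_.add_apply,
      _root_.smul_apply, LinearMap.add_apply, LinearMap.smul_apply, smul_eq_mul]
    ring
  have halin : ∀ p (c : ℝ) v v', a p (c • v + v') = c * a p v + a p v' := by
    intro p c v v'
    simp only [a, hβlin]; ring
  have hblin : ∀ p (c : ℝ) v v', b p (c • v + v') = c * b p v + b p v' := by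
    intro p c v v'
    simp only [b, hβlin]; ring
  let c : E → E → E → E := fun p v x ↦ a p v • x + b p v • J p x
  let Γf : E → E → E → E := fun p v x ↦ G p v x + (1 / 4 : ℝ) • (c p v x + c p x v)
  -- Bilinearity is needed at every `p`, since `Γ` is a total function. It survives vanishing
  -- denominators, where division returns `0`.
  have hΓlin : ∀ p, IsBilinearMap ℝ (Γf p) := by
    intro p
    have ha1 : ∀ v v', a p (v + v') = a p v + a p v' := fun v v' ↦ by
      simpa using halin p 1 v v'
    have ha0 : a p 0 = 0 := by simpa using ha1 0 0
    have ha2 : ∀ (c : ℝ) v, a p (c • v) = c * a p v := fun c v ↦ by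
      simpa [ha0] using halin p c v 0
    have hb1 : ∀ v v', b p (v + v') = b p v + b p v' := fun v v' ↦ by
      simpa using hblin p 1 v v'
    have hb0 : b p 0 = 0 := by simpa using hb1 0 0
    have hb2 : ∀ (c : ℝ) v, b p (c • v) = c * b p v := fun c v ↦ by
      simpa [hb0] using hblin p c v 0
    constructor <;> intros <;>
      simp only [Γf, c, ha1, ha2, hb1, hb2, map_add, map_smul, LinearMap.add_apply,
        LinearMap.smul_apply] <;> module
  -- On this neighbourhood the denominators of `a` and `b` do not vanish, so both are smooth there.
  let V : Set E := U ∩ (fun p ↦ W p u₁ u₂ u₃) ⁻¹' {0}ᶜ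
  have hV : IsOpen V := by
    refine ContinuousOn.isOpen_inter_preimage ?_ hU isOpen_compl_singleton
    have : ContDiffOn ℝ ∞ (fun p ↦ W p u₁ u₂ u₃) U :=
      ((hW.clm_apply contDiffOn_const).clm_apply contDiffOn_const).clm_apply contDiffOn_const
    exact this.continuousOn
  refine ⟨V, hV, ⟨hp₀, h0⟩, Set.inter_subset_left, fun p ↦ (hΓlin p).toContinuousBilinearMap,
    ?_, ?_⟩
  · rw [contDiffOn_clm_apply]
    intro v
    rw [contDiffOn_clm_apply]
    intro x
    simp only [IsBilinearMap.toContinuousBilinearMap_apply]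
    have hJV : ContDiffOn ℝ ∞ J V := hJ.mono Set.inter_subset_left
    have hWV : ContDiffOn ℝ ∞ W V := hW.mono Set.inter_subset_left
    have hdJ : ContDiffOn ℝ ∞ (fderiv ℝ J) V := hJV.fderiv_of_isOpen hV (by simp)
    have hdW : ContDiffOn ℝ ∞ (fderiv ℝ W) V := hWV.fderiv_of_isOpen hV (by simp)
    have hw : ∀ {f g h : E → E}, ContDiffOn ℝ ∞ f V → ContDiffOn ℝ ∞ g V → ContDiffOn ℝ ∞ h V →
        ContDiffOn ℝ ∞ (fun p ↦ w p (f p) (g p) (h p)) V := fun hf hg hh ↦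
      ((hWV.clm_apply hf).clm_apply hg).clm_apply hh
    have hD : ∀ {k f g h : E → E}, ContDiffOn ℝ ∞ k V → ContDiffOn ℝ ∞ f V →
        ContDiffOn ℝ ∞ g V → ContDiffOn ℝ ∞ h V →
        ContDiffOn ℝ ∞ (fun p ↦ D p (k p) (f p) (g p) (h p)) V := fun hk hf hg hh ↦
      (((hdW.clm_apply hk).clm_apply hf).clm_apply hg).clm_apply hh
    have hG : ∀ {k f : E → E}, ContDiffOn ℝ ∞ k V → ContDiffOn ℝ ∞ f V →
        ContDiffOn ℝ ∞ (fun p ↦ G p (k p) (f p)) V := fun {k f} hk hf ↦ by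
      simp only [G, acsCorrection_apply, hAapp, ContinuousLinearMap.coe_coe]
      exact contDiffOn_const.smul (((((hdJ.clm_apply (hJV.clm_apply hf)).clm_apply hk)).add
        (hJV.clm_apply ((hdJ.clm_apply hf).clm_apply hk))).add
        (contDiffOn_const.smul (hJV.clm_apply ((hdJ.clm_apply hk).clm_apply hf))))
    have hc : ∀ (v : E), ContDiffOn ℝ ∞ (fun _ : E ↦ v) V := fun v ↦ contDiffOn_const
    have hJc : ∀ (v : E), ContDiffOn ℝ ∞ (fun p : E ↦ J p v) V := fun v ↦ hJV.clm_apply (hc v)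
    have hβ : ∀ v {f : E → E}, ContDiffOn ℝ ∞ f V →
        ContDiffOn ℝ ∞ (fun p ↦ β p v (f p) u₂ u₃) V := fun v f hf ↦
      (((hD (hc v) hf (hc _) (hc _)).sub (hw (hG (hc v) hf) (hc _) (hc _))).sub
        (hw hf (hG (hc v) (hc _)) (hc _))).sub (hw hf (hc _) (hG (hc v) (hc _)))
    have hden : ∀ p ∈ V, w p u₁ u₂ u₃ ^ 2 + w p (J p u₁) u₂ u₃ ^ 2 ≠ 0 := fun p hp ↦ by
      have : w p u₁ u₂ u₃ ≠ 0 := hp.2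
      positivity
    have hw1 := hw (hc u₁) (hc u₂) (hc u₃)
    have hw2 := hw (hJc u₁) (hc u₂) (hc u₃)
    have ha : ∀ v, ContDiffOn ℝ ∞ (fun p ↦ a p v) V := fun v ↦
      (((hβ v (hc u₁)).mul hw1).add ((hβ v (hJc u₁)).mul hw2)).div
        ((hw1.pow 2).add (hw2.pow 2)) hden
    have hb : ∀ v, ContDiffOn ℝ ∞ (fun p ↦ b p v) V := fun v ↦
      (((hβ v (hc u₁)).mul hw2).sub ((hβ v (hJc u₁)).mul hw1)).div
        ((hw1.pow 2).add (hw2.pow 2)) hden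
    have hcc : ∀ v x, ContDiffOn ℝ ∞ (fun p ↦ c p v x) V := fun v x ↦
      ((ha v).smul (hc x)).add ((hb v).smul (hJc x))
    exact (hG (hc v) (hc x)).add (contDiffOn_const.smul ((hcc v x).add (hcc x v)))
  · intro p hp
    have hpU : p ∈ U := hp.1
    have hWd : DifferentiableAt ℝ W p :=
      (hW.contDiffAt (hU.mem_nhds hpU)).differentiableAt (by simp)
    have hJd : DifferentiableAt ℝ J p :=
      (hJ.contDiffAt (hU.mem_nhds hpU)).differentiableAt (by simp)
    have hUp : U ∈ nhds p := hU.mem_nhds hpU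
    have hGs : ∀ u v, G p u v = G p v u := acsCorrection_symm (hN p hpU)
    have hw := halt p hpU
    have hD : ∀ v, IsAltTrilinear (D p v) := by
      intro v
      refine ⟨by simp [D], by simp [D], fun x y z ↦ ?_, fun x y z ↦ ?_⟩
      · simp only [D]
        rw [← fderiv_apply₃ hWd, ← fderiv_apply₃ hWd]
        have : (fun q ↦ W q y x z) =ᶠ[nhds p] fun q ↦ - W q x y z := by
          filter_upwards [hUp] with q hq using (halt q hq).swap_left x y z
        rw [this.fderiv_eq, fderiv_fun_neg]; rfl
      · simp only [D]
        rw [← fderiv_apply₃ hWd, ← fderiv_apply₃ hWd]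
        have : (fun q ↦ W q x z y) =ᶠ[nhds p] fun q ↦ - W q x y z := by
          filter_upwards [hUp] with q hq using (halt q hq).swap_right x y z
        rw [this.fderiv_eq, fderiv_fun_neg]; rfl
    have hJder : ∀ x, HasFDerivAt (fun q ↦ J q x) ((fderiv ℝ J p).flip x) p := fun x ↦ by
      simpa using! hJd.hasFDerivAt.clm_apply (hasFDerivAt_const x p)
    -- Differentiate `J² = -1`.
    have hA : ∀ v x, A p v (J p x) = -(J p) (A p v x) := by
      intro v x
      have h1 := hJd.hasFDerivAt.clm_apply (hJder x)
      have h2 : (fun q ↦ J q (J q x)) =ᶠ[nhds p] fun _ ↦ -x := by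
        filter_upwards [hUp] with q hq using hJJ q hq x
      have h3 := (hasFDerivAt_const (𝕜 := ℝ) (-x) p).congr_of_eventuallyEq h2
      have := congrArg (fun L : E →L[ℝ] E ↦ L v) (h1.unique h3)
      simp at this
      simp only [hAapp]
      rw [eq_neg_iff_add_eq_zero, add_comm]
      exact this
    -- Differentiate the purity equation, with `J` varying.
    have hDJ : ∀ v x y z, D p v (J p x) y z + w p (A p v x) y z =
        D p v x (J p y) z + w p x (A p v y) z := by
      intro v x y z
      have h1 := ((hWd.hasFDerivAt.clm_apply (hJder x)).clm_apply
        (hasFDerivAt_const y p)).clm_apply (hasFDerivAt_const z p)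
      have h2 := ((hWd.hasFDerivAt.clm_apply (hasFDerivAt_const x p)).clm_apply
        (hJder y)).clm_apply (hasFDerivAt_const z p)
      have h3 : (fun q ↦ W q (J q x) y z) =ᶠ[nhds p] fun q ↦ W q x (J q y) z := by
        filter_upwards [hUp] with q hq using hpure q hq x y z
      have := congrArg (fun L : E →L[ℝ] ℝ ↦ L v) (h1.unique (h2.congr_of_eventuallyEq h3))
      simp at this
      simp only [hAapp, D, w]
      linarith
    have hβalt : ∀ v, IsAltTrilinear (β p v) := isAltTrilinear_derivCorrection hw hD (G p)
    have hβJ : ∀ v x y z, β p v (J p x) y z = β p v x (J p y) z :=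
      derivCorrection_pure hw (J := ((J p : E →L[ℝ] E) : E →ₗ[ℝ] E)) (hJJ p hpU) hA (hpure p hpU) hDJ
    have hc : ∀ v x y z, β p v x y z = w p (c p v x) y z := fun v x y z ↦
      IsAltTrilinear.eq_comp_of_pure hE (J := ((J p : E →L[ℝ] E) : E →ₗ[ℝ] E)) (hJJ p hpU) hw (hβalt v)
        (hpure p hpU) (hβJ v) hp.2 x y z
    refine ⟨fun u v ↦ ?_, fun v x y z ↦ ?_⟩
    · simp only [IsBilinearMap.toContinuousBilinearMap_apply, Γf]
      rw [hGs u v, add_comm (c p u v)]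
    · exact deriv_eq_of_closed (c := c p) hw hGs (hclosed p hpU) hc hβalt v x y z

end Local

/-! ### Coordinate expressions on a 6-manifold -/

section Coordinates

lemma source_mem_nhds {M : Type*} [TopologicalSpace M] [ChartedSpace R6 M] {x₀ x : M}
    (hx : x ∈ (chartAt R6 x₀).source) : (chartAt R6 x₀).source ∈ nhds x :=
  (chartAt R6 x₀).open_source.mem_nhds hx

variable {M : Type*} [TopologicalSpace M] [ChartedSpace R6 M] [IsManifold (𝓡 6) ∞ M]

/-- The tangent map of the chart at `x₀`, at the point `x`. -/
def toCoord (x₀ x : M) : TangentSpace (𝓡 6) x →L[ℝ] R6 :=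
  (trivializationAt R6 (TangentSpace (𝓡 6) : M → Type _) x₀).continuousLinearMapAt ℝ x

/-- The inverse of the tangent map of the chart at `x₀`, at the point `x`. -/
def ofCoord (x₀ x : M) : R6 →L[ℝ] TangentSpace (𝓡 6) x :=
  (trivializationAt R6 (TangentSpace (𝓡 6) : M → Type _) x₀).symmL ℝ x

variable {x₀ x : M}

lemma mem_baseSet_of_mem_source (hx : x ∈ (chartAt R6 x₀).source) :
    x ∈ (trivializationAt R6 (TangentSpace (𝓡 6) : M → Type _) x₀).baseSet := by
  simpa using hx

lemma toCoord_ofCoord (hx : x ∈ (chartAt R6 x₀).source) (u : R6) :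
    toCoord x₀ x (ofCoord x₀ x u) = u :=
  Trivialization.continuousLinearMapAt_symmL _ (mem_baseSet_of_mem_source hx) u

lemma ofCoord_toCoord (hx : x ∈ (chartAt R6 x₀).source) (v : TangentSpace (𝓡 6) x) :
    ofCoord x₀ x (toCoord x₀ x v) = v :=
  Trivialization.symmL_continuousLinearMapAt _ (mem_baseSet_of_mem_source hx) v

lemma toCoord_eq_mfderiv (hx : x ∈ (chartAt R6 x₀).source) :
    toCoord x₀ x = mfderiv (𝓡 6) 𝓘(ℝ, R6) (extChartAt (𝓡 6) x₀) x :=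
  TangentBundle.continuousLinearMapAt_trivializationAt hx

lemma ofCoord_eq_mfderiv (hx : x ∈ (chartAt R6 x₀).source) :
    ofCoord x₀ x =
      mfderiv 𝓘(ℝ, R6) (𝓡 6) (extChartAt (𝓡 6) x₀).symm (extChartAt (𝓡 6) x₀ x) := by
  rw [ofCoord, TangentBundle.symmL_trivializationAt hx]
  simp
  rfl

variable {F : Type*} [NormedAddCommGroup F] [NormedSpace ℝ F]

lemma contMDiffAt_iff_contDiffAt_comp_symm {f : M → F} (hx : x ∈ (chartAt R6 x₀).source) :
    ContMDiffAt (𝓡 6) 𝓘(ℝ, F) ∞ f x ↔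
      ContDiffAt ℝ ∞ (f ∘ (extChartAt (𝓡 6) x₀).symm) (extChartAt (𝓡 6) x₀ x) := by
  rw [contMDiffAt_iff_source_of_mem_source hx]
  simp [contMDiffAt_iff_contDiffAt, contMDiffWithinAt_univ]

lemma mdifferentiableAt_iff_differentiableAt_comp_symm {f : M → F}
    (hx : x ∈ (chartAt R6 x₀).source) :
    MDifferentiableAt (𝓡 6) 𝓘(ℝ, F) f x ↔
      DifferentiableAt ℝ (f ∘ (extChartAt (𝓡 6) x₀).symm) (extChartAt (𝓡 6) x₀ x) := by
  rw [mdifferentiableAt_iff_source_of_mem_source hx]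
  simp [mdifferentiableAt_iff_differentiableAt, mdifferentiableWithinAt_univ]

lemma mvfderiv_eq_fderiv_comp_symm {f : M → F} (hx : x ∈ (chartAt R6 x₀).source)
    (hf : MDifferentiableAt (𝓡 6) 𝓘(ℝ, F) f x) (v : TangentSpace (𝓡 6) x) :
    mvfderiv (𝓡 6) f x v =
      fderiv ℝ (f ∘ (extChartAt (𝓡 6) x₀).symm) (extChartAt (𝓡 6) x₀ x) (toCoord x₀ x v) := by
  have h1 : f =ᶠ[nhds x] (f ∘ (extChartAt (𝓡 6) x₀).symm) ∘ extChartAt (𝓡 6) x₀ := by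
    have : (chartAt R6 x₀).source ∈ nhds x := (chartAt R6 x₀).open_source.mem_nhds hx
    filter_upwards [this] with z hz
    simp only [Function.comp_apply]
    rw [(extChartAt (𝓡 6) x₀).left_inv (by simpa using hz)]
  have hd : MDifferentiableAt 𝓘(ℝ, R6) 𝓘(ℝ, F) (f ∘ (extChartAt (𝓡 6) x₀).symm)
      (extChartAt (𝓡 6) x₀ x) :=
    ((mdifferentiableAt_iff_differentiableAt_comp_symm hx).1 hf).mdifferentiableAt
  have h2 : HasMFDerivAt (𝓡 6) 𝓘(ℝ, F) f x _ :=
    (hd.hasMFDerivAt.comp x (mdifferentiableAt_extChartAt hx).hasMFDerivAt).congr_of_eventuallyEq h1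
  rw [mvfderiv, h2.mfderiv, toCoord_eq_mfderiv hx, mfderiv_eq_fderiv]
  rfl

/-- The coordinate expression of a vector field in the chart at `x₀`. -/
def coordVField (x₀ : M) (X : VField M) (y : R6) : R6 :=
  toCoord x₀ ((extChartAt (𝓡 6) x₀).symm y) (X ((extChartAt (𝓡 6) x₀).symm y))

lemma coordVField_apply (hx : x ∈ (chartAt R6 x₀).source) (X : VField M) :
    coordVField x₀ X (extChartAt (𝓡 6) x₀ x) = toCoord x₀ x (X x) := by
  rw [coordVField, (extChartAt (𝓡 6) x₀).left_inv (by simpa using hx)]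

lemma contMDiffAt_iff_coordVField (hx : x ∈ (chartAt R6 x₀).source) {X : VField M} :
    ContMDiffAt (𝓡 6) (𝓡 6).tangent ∞ (fun x ↦ (⟨x, X x⟩ : TangentBundle (𝓡 6) M)) x ↔
      ContDiffAt ℝ ∞ (coordVField x₀ X) (extChartAt (𝓡 6) x₀ x) := by
  have e := (trivializationAt R6 (TangentSpace (𝓡 6) : M → Type _) x₀).contMDiffAt_section_iff
    (IB := 𝓡 6) (n := ∞) (s := X) (mem_baseSet_of_mem_source hx)
  refine e.trans ?_
  have : (fun x ↦ ((trivializationAt R6 (TangentSpace (𝓡 6) : M → Type _) x₀) ⟨x, X x⟩).2)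
      =ᶠ[nhds x] fun x ↦ toCoord x₀ x (X x) := by
    filter_upwards [source_mem_nhds hx] with z hz
    exact (Trivialization.continuousLinearMapAt_apply_of_mem ℝ _
      (mem_baseSet_of_mem_source hz) _).symm
  rw [this.contMDiffAt_iff, contMDiffAt_iff_contDiffAt_comp_symm hx]
  rfl

lemma mdifferentiableAt_iff_coordVField (hx : x ∈ (chartAt R6 x₀).source) {X : VField M} :
    MDifferentiableAt (𝓡 6) (𝓡 6).tangent (fun x ↦ (⟨x, X x⟩ : TangentBundle (𝓡 6) M)) x ↔
      DifferentiableAt ℝ (coordVField x₀ X) (extChartAt (𝓡 6) x₀ x) := by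
  have e := (trivializationAt R6 (TangentSpace (𝓡 6) : M → Type _) x₀).mdifferentiableAt_section_iff
    (𝓡 6) X (mem_baseSet_of_mem_source hx)
  refine e.trans ?_
  have : (fun x ↦ ((trivializationAt R6 (TangentSpace (𝓡 6) : M → Type _) x₀) ⟨x, X x⟩).2)
      =ᶠ[nhds x] fun x ↦ toCoord x₀ x (X x) := by
    filter_upwards [source_mem_nhds hx] with z hz
    exact (Trivialization.continuousLinearMapAt_apply_of_mem ℝ _
      (mem_baseSet_of_mem_source hz) _).symm
  rw [this.mdifferentiableAt_iff, mdifferentiableAt_iff_differentiableAt_comp_symm hx]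
  rfl

lemma toCoord_injective (hx : x ∈ (chartAt R6 x₀).source) :
    Function.Injective (toCoord x₀ x) := fun v w h ↦ by
  rw [← ofCoord_toCoord hx v, h, ofCoord_toCoord hx]

lemma inverse_mfderiv_extChartAt (hx : x ∈ (chartAt R6 x₀).source) (u : R6) :
    (mfderiv (𝓡 6) 𝓘(ℝ, R6) (extChartAt (𝓡 6) x₀) x).inverse u = ofCoord x₀ x u := by
  have hinv := isInvertible_mfderiv_extChartAt (I := 𝓡 6) (x := x₀) (y := x) (by simpa using hx)
  apply toCoord_injective hx
  rw [toCoord_ofCoord hx, toCoord_eq_mfderiv hx]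
  exact hinv.self_apply_inverse u

/-- Near `x` each vector field is the pullback under the chart of its coordinate expression, and
brackets commute with pullback. -/
lemma toCoord_mlieBracket (hx : x ∈ (chartAt R6 x₀).source) {X Y : VField M}
    (hX : MDifferentiableAt (𝓡 6) (𝓡 6).tangent (fun x ↦ (⟨x, X x⟩ : TangentBundle (𝓡 6) M)) x)
    (hY : MDifferentiableAt (𝓡 6) (𝓡 6).tangent (fun x ↦ (⟨x, Y x⟩ : TangentBundle (𝓡 6) M)) x) :
    toCoord x₀ x (VectorField.mlieBracket (𝓡 6) X Y x) =
      VectorField.lieBracket ℝ (coordVField x₀ X) (coordVField x₀ Y) (extChartAt (𝓡 6) x₀ x) := by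
  let c : VField M → ∀ y : R6, TangentSpace 𝓘(ℝ, R6) y := coordVField x₀
  have key : ∀ Z : VField M, Z =ᶠ[nhds x]
      VectorField.mpullback (𝓡 6) 𝓘(ℝ, R6) (extChartAt (𝓡 6) x₀) (c Z) := fun Z ↦ by
    filter_upwards [source_mem_nhds hx] with z hz
    have h1 := inverse_mfderiv_extChartAt hz (coordVField x₀ Z (extChartAt (𝓡 6) x₀ z))
    have h2 : ofCoord x₀ z (coordVField x₀ Z (extChartAt (𝓡 6) x₀ z)) = Z z := by
      rw [coordVField_apply hz, ofCoord_toCoord hz]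
    exact (h1.trans h2).symm
  have hd : ∀ Z : VField M,
      MDifferentiableAt (𝓡 6) (𝓡 6).tangent (fun x ↦ (⟨x, Z x⟩ : TangentBundle (𝓡 6) M)) x →
      MDifferentiableAt 𝓘(ℝ, R6) 𝓘(ℝ, R6).tangent
        (fun y ↦ (⟨y, c Z y⟩ : TangentBundle 𝓘(ℝ, R6) R6)) (extChartAt (𝓡 6) x₀ x) := by
    intro Z hZ
    have := (mdifferentiableAt_iff_coordVField hx).1 hZ
    rw [mdifferentiableAt_totalSpace]
    refine ⟨mdifferentiableAt_id, ?_⟩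
    simp only [trivializationAt_model_space_apply]
    exact this.mdifferentiableAt
  have hn : minSmoothness ℝ 2 ≤ (∞ : ℕ∞ω) := by
    rw [minSmoothness_of_isRCLikeNormedField]
    exact WithTop.coe_le_coe.2 (le_top : (2 : ℕ∞) ≤ ⊤)
  have : IsManifold (𝓡 6) (minSmoothness ℝ 2) M := IsManifold.of_le hn
  have h1 := VectorField.mpullback_mlieBracket (n := ∞) (I := 𝓡 6) (I' := 𝓘(ℝ, R6)) (hd X hX)
    (hd Y hY) (contMDiffAt_extChartAt' (n := ∞) hx) hn
  have h2 := Filter.EventuallyEq.mlieBracket_vectorField_eq (key X) (key Y)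
  have h3 := inverse_mfderiv_extChartAt hx
    (VectorField.mlieBracket 𝓘(ℝ, R6) (c X) (c Y) (extChartAt (𝓡 6) x₀ x))
  have h4 : VectorField.mlieBracket 𝓘(ℝ, R6) (c X) (c Y) (extChartAt (𝓡 6) x₀ x) =
      VectorField.lieBracket ℝ (coordVField x₀ X) (coordVField x₀ Y) (extChartAt (𝓡 6) x₀ x) := by
    rw [← VectorField.mlieBracketWithin_univ, VectorField.mlieBracketWithin_eq_lieBracketWithin,
      VectorField.lieBracketWithin_univ]
  have h5 : VectorField.mlieBracket (𝓡 6) X Y x = ofCoord x₀ x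
      (VectorField.lieBracket ℝ (coordVField x₀ X) (coordVField x₀ Y) (extChartAt (𝓡 6) x₀ x)) :=
    (h2.trans h1.symm).trans (h3.trans (congrArg (ofCoord x₀ x) h4))
  rw [h5, toCoord_ofCoord hx]

end Coordinates

/-! ### Coordinate expressions of 3-forms -/

section Curry

variable {E : Type*} [NormedAddCommGroup E] [NormedSpace ℝ E]

/-- The trilinear map underlying an alternating 3-form, in curried form. -/
def curryForm : (E [⋀^Fin 3]→L[ℝ] ℝ) →L[ℝ] E →L[ℝ] E →L[ℝ] E →L[ℝ] ℝ :=
  let c1 : (E [×1]→L[ℝ] ℝ) →L[ℝ] E →L[ℝ] ℝ :=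
    (ContinuousLinearMap.compL ℝ E (E [×0]→L[ℝ] ℝ) ℝ
      (continuousMultilinearCurryFin0 ℝ E ℝ).toContinuousLinearEquiv.toContinuousLinearMap).comp
      (continuousMultilinearCurryLeftEquiv ℝ (fun _ : Fin 1 ↦ E)
        ℝ).toContinuousLinearEquiv.toContinuousLinearMap
  let c2 : (E [×2]→L[ℝ] ℝ) →L[ℝ] E →L[ℝ] E →L[ℝ] ℝ :=
    (ContinuousLinearMap.compL ℝ E (E [×1]→L[ℝ] ℝ) (E →L[ℝ] ℝ) c1).comp
      (continuousMultilinearCurryLeftEquiv ℝ (fun _ : Fin 2 ↦ E)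
        ℝ).toContinuousLinearEquiv.toContinuousLinearMap
  let c3 : (E [×3]→L[ℝ] ℝ) →L[ℝ] E →L[ℝ] E →L[ℝ] E →L[ℝ] ℝ :=
    (ContinuousLinearMap.compL ℝ E (E [×2]→L[ℝ] ℝ) (E →L[ℝ] E →L[ℝ] ℝ) c2).comp
      (continuousMultilinearCurryLeftEquiv ℝ (fun _ : Fin 3 ↦ E)
        ℝ).toContinuousLinearEquiv.toContinuousLinearMap
  c3.comp (ContinuousAlternatingMap.toContinuousMultilinearMapCLM ℝ)

lemma curryForm_apply (w : E [⋀^Fin 3]→L[ℝ] ℝ) (x y z : E) :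
    curryForm w x y z = w ![x, y, z] := by
  simp [curryForm]

lemma isAltTrilinear_alternating {V : Type*} [AddCommGroup V] [Module ℝ V] [TopologicalSpace V]
    (w : V [⋀^Fin 3]→L[ℝ] ℝ) : IsAltTrilinear (fun x y z ↦ w ![x, y, z]) where
  add_left x x' y z := by
    have e : ∀ t, Function.update ![x, y, z] 0 t = ![t, y, z] := fun t ↦ by
      ext i; fin_cases i <;> rfl
    simpa only [e] using w.map_update_add ![x, y, z] 0 x x'
  smul_left c x y z := by
    have e : ∀ t, Function.update ![x, y, z] 0 t = ![t, y, z] := fun t ↦ by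
      ext i; fin_cases i <;> rfl
    simpa only [e, smul_eq_mul] using w.map_update_smul ![x, y, z] 0 c x
  swap_left x y z := by
    have := w.toAlternatingMap.map_swap ![x, y, z] (i := 0) (j := 1) (by decide)
    rw [← ContinuousAlternatingMap.coe_toAlternatingMap, ← this]
    congr 1
    ext i; fin_cases i <;> rfl
  swap_right x y z := by
    have := w.toAlternatingMap.map_swap ![x, y, z] (i := 1) (j := 2) (by decide)
    rw [← ContinuousAlternatingMap.coe_toAlternatingMap, ← this]
    congr 1
    ext i; fin_cases i <;> rfl

lemma fderiv_clm_comp_apply {F G : Type*} [NormedAddCommGroup F] [NormedSpace ℝ F]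
    [NormedAddCommGroup G] [NormedSpace ℝ G] (A : F →L[ℝ] G) {f : E → F} {p : E}
    (hf : DifferentiableAt ℝ f p) (u : E) :
    fderiv ℝ (fun q ↦ A (f q)) p u = A (fderiv ℝ f p u) := by
  have h : HasFDerivAt (fun q ↦ A (f q)) (A.comp (fderiv ℝ f p)) p :=
    A.hasFDerivAt.comp p hf.hasFDerivAt
  rw [h.fderiv]
  rfl

lemma extDeriv_apply_cons {η : E → E [⋀^Fin 3]→L[ℝ] ℝ} {p : E} (hη : DifferentiableAt ℝ η p)
    (v x y z : E) :
    extDeriv η p ![v, x, y, z] =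
      fderiv ℝ (fun q ↦ curryForm (η q)) p v x y z - fderiv ℝ (fun q ↦ curryForm (η q)) p x v y z +
      fderiv ℝ (fun q ↦ curryForm (η q)) p y v x z - fderiv ℝ (fun q ↦ curryForm (η q)) p z v x y := by
  have h : ∀ u, fderiv ℝ (fun q ↦ curryForm (η q)) p u = curryForm (fderiv ℝ η p u) :=
    fderiv_clm_comp_apply curryForm hη
  simp only [h, curryForm_apply]
  rw [extDeriv, ContinuousAlternatingMap.alternatizeUncurryFin_apply, Fin.sum_univ_four]
  have r0 : (0 : Fin 4).removeNth ![v, x, y, z] = ![x, y, z] := by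
    ext i; fin_cases i <;> rfl
  have r1 : (1 : Fin 4).removeNth ![v, x, y, z] = ![v, y, z] := by
    ext i; fin_cases i <;> rfl
  have r2 : (2 : Fin 4).removeNth ![v, x, y, z] = ![v, x, z] := by
    ext i; fin_cases i <;> rfl
  have r3 : (3 : Fin 4).removeNth ![v, x, y, z] = ![v, x, y] := by
    ext i; fin_cases i <;> rfl
  rw [r0, r1, r2, r3]
  simp
  ring

/-- Forms of type 2 are non-degenerate. -/
lemma eq_zero_of_formDelta {V : Type*} [AddCommGroup V] [Module ℝ V] [TopologicalSpace V]
    {w : V [⋀^Fin 3]→L[ℝ] ℝ} (hw : formDelta w = {0}) {v : V} (h : ∀ x y, w ![v, x, y] = 0) :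
    v = 0 := by
  have : v ∈ formDelta w := by
    have h0 : w.toAlternatingMap.curryLeft v = 0 := by
      ext m
      have : m = ![m 0, m 1] := by ext i; fin_cases i <;> rfl
      rw [this]
      exact h _ _
    simp only [formDelta, Set.mem_ofPred_eq, h0]
    have h1 : AlternatingMap.domCoprod (0 : V [⋀^Fin 2]→ₗ[ℝ] ℝ) (0 : V [⋀^Fin 2]→ₗ[ℝ] ℝ) = 0 := by
      rw [← AlternatingMap.domCoprod'_apply, TensorProduct.zero_tmul, map_zero]
    ext m
    simp [altWedge, h1]
  rw [hw] at this
  exact this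

end Curry

/-! ### 3-forms, endomorphism fields and exterior derivatives in charts -/

section CoordinateForms

variable {M : Type*} [TopologicalSpace M] [ChartedSpace R6 M]

/-- The coordinate expression of a 3-form in the chart at `x₀`, in curried form. -/
def coordForm (Ω : FormField M 3) (x₀ : M) (y : R6) : R6 →L[ℝ] R6 →L[ℝ] R6 →L[ℝ] ℝ :=
  curryForm (chartForm Ω x₀ y)

lemma isAltTrilinear_coordForm (Ω : FormField M 3) (x₀ : M) (y : R6) :
    IsAltTrilinear (fun u v w ↦ coordForm Ω x₀ y u v w) := by
  simpa only [coordForm, curryForm_apply] using isAltTrilinear_alternating (chartForm Ω x₀ y)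

lemma contDiffOn_coordForm {Ω : FormField M 3} (hΩ : IsSmoothForm Ω) (x₀ : M) :
    ContDiffOn ℝ ∞ (coordForm Ω x₀) (extChartAt (𝓡 6) x₀).target :=
  (curryForm (E := R6)).contDiff.comp_contDiffOn (hΩ x₀)

lemma isOpen_target (x₀ : M) : IsOpen (extChartAt (𝓡 6) x₀).target :=
  isOpen_extChartAt_target x₀

lemma mem_target {x₀ x : M} (hx : x ∈ (chartAt R6 x₀).source) :
    extChartAt (𝓡 6) x₀ x ∈ (extChartAt (𝓡 6) x₀).target :=
  (extChartAt (𝓡 6) x₀).map_source (by simpa using hx)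

lemma differentiableAt_chartForm {k : ℕ} {Ω : FormField M k} (hΩ : IsSmoothForm Ω)
    (hx : x ∈ (chartAt R6 x₀).source) :
    DifferentiableAt ℝ (chartForm Ω x₀) (extChartAt (𝓡 6) x₀ x) :=
  ((hΩ x₀).contDiffAt ((isOpen_target x₀).mem_nhds (mem_target hx))).differentiableAt (by simp)

lemma exists_eq_of_mem_target {x₀ : M} {y : R6} (hy : y ∈ (extChartAt (𝓡 6) x₀).target) :
    ∃ x ∈ (chartAt R6 x₀).source, extChartAt (𝓡 6) x₀ x = y :=
  ⟨(extChartAt (𝓡 6) x₀).symm y, by simpa using (extChartAt (𝓡 6) x₀).map_target hy,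
    (extChartAt (𝓡 6) x₀).right_inv hy⟩

lemma symm_extChartAt {x₀ x : M} (hx : x ∈ (chartAt R6 x₀).source) :
    (extChartAt (𝓡 6) x₀).symm (extChartAt (𝓡 6) x₀ x) = x :=
  (extChartAt (𝓡 6) x₀).left_inv (by simpa using hx)

variable [IsManifold (𝓡 6) ∞ M] {x₀ x : M}

lemma chartForm_apply {k : ℕ} (Ω : FormField M k) (hx : x ∈ (chartAt R6 x₀).source)
    (u : Fin k → R6) :
    chartForm Ω x₀ (extChartAt (𝓡 6) x₀ x) u = Ω x (fun i ↦ ofCoord x₀ x (u i)) := by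
  -- The chart returns to `x` only up to a propositional equality on which the fibre types depend; a
  -- free point `z` allows substitution.
  have key : ∀ z, z = x → ∀ u : Fin k → R6,
      (Ω z).compContinuousLinearMap (ofCoord x₀ z) u = Ω x (fun i ↦ ofCoord x₀ x (u i)) := by
    rintro z rfl u
    rfl
  rw [← key _ (symm_extChartAt hx) u]
  have h : ofCoord x₀ ((extChartAt (𝓡 6) x₀).symm (extChartAt (𝓡 6) x₀ x)) =
      mfderiv 𝓘(ℝ, R6) (𝓡 6) (extChartAt (𝓡 6) x₀).symm (extChartAt (𝓡 6) x₀ x) := by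
    have h1 := ofCoord_eq_mfderiv
      (x := (extChartAt (𝓡 6) x₀).symm (extChartAt (𝓡 6) x₀ x)) (x₀ := x₀)
      (by rwa [symm_extChartAt hx])
    rw [h1, (extChartAt (𝓡 6) x₀).right_inv (mem_target hx)]
  rw [h]
  rfl

lemma coordForm_apply (Ω : FormField M 3) (hx : x ∈ (chartAt R6 x₀).source) (u v w : R6) :
    coordForm Ω x₀ (extChartAt (𝓡 6) x₀ x) u v w =
      Ω x ![ofCoord x₀ x u, ofCoord x₀ x v, ofCoord x₀ x w] := by
  rw [coordForm, curryForm_apply, chartForm_apply Ω hx]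
  congr 1
  ext i; fin_cases i <;> rfl

lemma coordForm_toCoord (Ω : FormField M 3) (hx : x ∈ (chartAt R6 x₀).source)
    (u v w : TangentSpace (𝓡 6) x) :
    coordForm Ω x₀ (extChartAt (𝓡 6) x₀ x) (toCoord x₀ x u) (toCoord x₀ x v) (toCoord x₀ x w) =
      Ω x ![u, v, w] := by
  rw [coordForm_apply Ω hx, ofCoord_toCoord hx, ofCoord_toCoord hx, ofCoord_toCoord hx]

/-- The coordinate expression of an endomorphism field in the chart at `x₀`. -/
def coordEnd (J : EndField M) (x₀ : M) (y : R6) : R6 →L[ℝ] R6 :=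
  (toCoord x₀ ((extChartAt (𝓡 6) x₀).symm y)).comp
    ((J ((extChartAt (𝓡 6) x₀).symm y)).comp (ofCoord x₀ ((extChartAt (𝓡 6) x₀).symm y)))

lemma coordEnd_apply (J : EndField M) (hx : x ∈ (chartAt R6 x₀).source) (u : R6) :
    coordEnd J x₀ (extChartAt (𝓡 6) x₀ x) u = toCoord x₀ x (J x (ofCoord x₀ x u)) := by
  rw [coordEnd, symm_extChartAt hx]
  rfl

lemma coordEnd_toCoord (J : EndField M) (hx : x ∈ (chartAt R6 x₀).source)
    (v : TangentSpace (𝓡 6) x) :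
    coordEnd J x₀ (extChartAt (𝓡 6) x₀ x) (toCoord x₀ x v) = toCoord x₀ x (J x v) := by
  rw [coordEnd_apply J hx, ofCoord_toCoord hx]

/-- The trivialization of the endomorphism bundle is conjugation by the tangent trivialization,
which is `coordEnd`. -/
lemma contMDiffAt_iff_coordEnd (hx : x ∈ (chartAt R6 x₀).source) {A : EndField M} :
    ContMDiffAt (𝓡 6) ((𝓡 6).prod 𝓘(ℝ, R6 →L[ℝ] R6)) ∞
      (fun x => (⟨x, A x⟩ : TotalSpace (R6 →L[ℝ] R6)
        (fun x : M => TangentSpace (𝓡 6) x →L[ℝ] TangentSpace (𝓡 6) x))) x ↔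
      ContDiffAt ℝ ∞ (coordEnd A x₀) (extChartAt (𝓡 6) x₀ x) := by
  have e := (trivializationAt (R6 →L[ℝ] R6)
    (fun x : M => TangentSpace (𝓡 6) x →L[ℝ] TangentSpace (𝓡 6) x) x₀).contMDiffAt_section_iff
    (IB := 𝓡 6) (n := ∞) (s := A)
    (by rw [hom_trivializationAt_baseSet]
        exact ⟨mem_baseSet_of_mem_source hx, mem_baseSet_of_mem_source hx⟩)
  refine e.trans ?_
  have h := contMDiffAt_iff_contDiffAt_comp_symm (F := R6 →L[ℝ] R6) hx
    (f := fun x ↦ (toCoord x₀ x).comp ((A x).comp (ofCoord x₀ x)))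
  exact h

lemma contDiffOn_coordEnd {J : EndField M} (hJ : IsAlmostComplexStructure J) (x₀ : M) :
    ContDiffOn ℝ ∞ (coordEnd J x₀) (extChartAt (𝓡 6) x₀).target := by
  intro y hy
  obtain ⟨x, hx, rfl⟩ := exists_eq_of_mem_target hy
  exact ((contMDiffAt_iff_coordEnd hx).1 (hJ.smooth x)).contDiffWithinAt

lemma coordEnd_coordEnd {J : EndField M} (hJ : IsAlmostComplexStructure J)
    (hx : x ∈ (chartAt R6 x₀).source) (u : R6) :
    coordEnd J x₀ (extChartAt (𝓡 6) x₀ x) (coordEnd J x₀ (extChartAt (𝓡 6) x₀ x) u) = -u := by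
  rw [coordEnd_apply J hx u, coordEnd_toCoord J hx, hJ.sq, map_neg, toCoord_ofCoord hx]

lemma coordForm_coordEnd {Ω : FormField M 3} {J : EndField M}
    (hpure : ∀ x : M, IsPureForm (Ω x) (J x)) (hx : x ∈ (chartAt R6 x₀).source) (u v w : R6) :
    coordForm Ω x₀ (extChartAt (𝓡 6) x₀ x) (coordEnd J x₀ (extChartAt (𝓡 6) x₀ x) u) v w =
      coordForm Ω x₀ (extChartAt (𝓡 6) x₀ x) u (coordEnd J x₀ (extChartAt (𝓡 6) x₀ x) v) w := by
  rw [coordEnd_apply J hx, coordEnd_apply J hx, coordForm_apply Ω hx, coordForm_apply Ω hx,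
    ofCoord_toCoord hx, ofCoord_toCoord hx]
  exact (hpure x _ _ _).1

lemma coordVField_end (J : EndField M) (X : VField M) {y : R6}
    (hy : y ∈ (extChartAt (𝓡 6) x₀).target) :
    coordVField x₀ (fun z ↦ J z (X z)) y = coordEnd J x₀ y (coordVField x₀ X y) := by
  obtain ⟨x, hx, rfl⟩ := exists_eq_of_mem_target hy
  have := coordVField_apply hx (fun z ↦ J z (X z))
  rw [this, coordVField_apply hx, coordEnd_toCoord J hx]

lemma IsSmoothVField.mdifferentiableAt {X : VField M} (hX : IsSmoothVField X) (x : M) :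
    MDifferentiableAt (𝓡 6) (𝓡 6).tangent (fun x ↦ (⟨x, X x⟩ : TangentBundle (𝓡 6) M)) x :=
  (hX x).mdifferentiableAt (by simp)

lemma IsSmoothVField.end_apply {J : EndField M} (hJ : IsAlmostComplexStructure J) {X : VField M}
    (hX : IsSmoothVField X) : IsSmoothVField (fun z ↦ J z (X z)) := fun x ↦ by
  have hx : x ∈ (chartAt R6 x).source := mem_chart_source R6 x
  rw [contMDiffAt_iff_coordVField hx]
  have h1 := (contMDiffAt_iff_coordVField hx).1 (hX x)
  have h2 := (contMDiffAt_iff_coordEnd hx).1 (hJ.smooth x)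
  refine (h2.clm_apply h1).congr_of_eventuallyEq ?_
  filter_upwards [(isOpen_target x).mem_nhds (mem_target hx)] with y hy
  exact coordVField_end J X hy

lemma exists_coordForm_ne_zero {Ω : FormField M 3} (hΔ : ∀ x : M, formDelta (Ω x) = {0})
    (hx : x ∈ (chartAt R6 x₀).source) :
    ∃ u v w, coordForm Ω x₀ (extChartAt (𝓡 6) x₀ x) u v w ≠ 0 := by
  by_contra! h
  obtain ⟨u, hu⟩ := exists_ne (0 : R6)
  apply hu
  have : ofCoord x₀ x u = 0 := eq_zero_of_formDelta (hΔ x) fun v w ↦ by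
    have := h u (toCoord x₀ x v) (toCoord x₀ x w)
    rwa [coordForm_apply Ω hx, ofCoord_toCoord hx, ofCoord_toCoord hx] at this
  rw [← toCoord_ofCoord hx u, this, map_zero]

lemma fderiv_transition {x₁ : M} (hx : x ∈ (chartAt R6 x₀).source)
    (hx₁ : x ∈ (chartAt R6 x₁).source) (u : R6) :
    fderiv ℝ (extChartAt (𝓡 6) x₁ ∘ (extChartAt (𝓡 6) x₀).symm) (extChartAt (𝓡 6) x₀ x) u =
      toCoord x₁ x (ofCoord x₀ x u) := by
  have h := mvfderiv_eq_fderiv_comp_symm hx (mdifferentiableAt_extChartAt (I := 𝓡 6) hx₁)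
    (ofCoord x₀ x u)
  rw [toCoord_ofCoord hx] at h
  rw [toCoord_eq_mfderiv hx₁]
  exact h.symm

lemma extDeriv_chartForm_self_eq_zero {k : ℕ} {Ω : FormField M k} (h : mextDeriv Ω x = 0) :
    extDeriv (chartForm Ω x) (extChartAt (𝓡 6) x x) = 0 := by
  ext u
  have h1 : mextDeriv Ω x (fun i ↦ ofCoord x x (u i)) = 0 := by rw [h]; rfl
  have hx : x ∈ (chartAt R6 x).source := mem_chart_source R6 x
  have h2 : mextDeriv Ω x (fun i ↦ ofCoord x x (u i)) =
      extDeriv (chartForm Ω x) (extChartAt (𝓡 6) x x)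
        (fun i ↦ toCoord x x (ofCoord x x (u i))) := by
    rw [toCoord_eq_mfderiv hx]
    rfl
  simp only [toCoord_ofCoord hx] at h2
  rw [← h2, h1]
  rfl

/-- `mextDeriv` uses a different chart at each point, whereas the local construction needs
closedness throughout one chart. Naturality of the exterior derivative under the transition map `τ`
bridges the two. -/
lemma extDeriv_chartForm_eq_zero {k : ℕ} {Ω : FormField M k} (hΩ : IsSmoothForm Ω)
    (h : mextDeriv Ω x = 0) (hx : x ∈ (chartAt R6 x₀).source) :
    extDeriv (chartForm Ω x₀) (extChartAt (𝓡 6) x₀ x) = 0 := by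
  have hxx : x ∈ (chartAt R6 x).source := mem_chart_source R6 x
  let τ : R6 → R6 := extChartAt (𝓡 6) x ∘ (extChartAt (𝓡 6) x₀).symm
  have hτx : τ (extChartAt (𝓡 6) x₀ x) = extChartAt (𝓡 6) x x := by
    simp only [τ, Function.comp_apply, symm_extChartAt hx]
  have hc : ContinuousAt (extChartAt (𝓡 6) x₀).symm (extChartAt (𝓡 6) x₀ x) :=
    continuousAt_extChartAt_symm'' (mem_target hx)
  have hnear : ∀ᶠ y in nhds (extChartAt (𝓡 6) x₀ x),
      (extChartAt (𝓡 6) x₀).symm y ∈ (chartAt R6 x).source :=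
    hc.eventually (p := fun z ↦ z ∈ (chartAt R6 x).source)
      (by rw [symm_extChartAt hx]; exact source_mem_nhds hxx)
  have heq : chartForm Ω x₀ =ᶠ[nhds (extChartAt (𝓡 6) x₀ x)]
      fun y ↦ (chartForm Ω x (τ y)).compContinuousLinearMap (fderiv ℝ τ y) := by
    filter_upwards [(isOpen_target x₀).mem_nhds (mem_target hx), hnear] with y hy hy'
    obtain ⟨z, hz, rfl⟩ := exists_eq_of_mem_target hy
    rw [symm_extChartAt hz] at hy'
    have hτz : τ (extChartAt (𝓡 6) x₀ z) = extChartAt (𝓡 6) x z := by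
      simp only [τ, Function.comp_apply, symm_extChartAt hz]
    ext u
    rw [chartForm_apply Ω hz, ContinuousAlternatingMap.compContinuousLinearMap_apply, hτz,
      chartForm_apply Ω hy']
    congr 1
    ext1 i
    simp only [Function.comp_apply]
    rw [fderiv_transition hz hy', ofCoord_toCoord hy']
  have hω : DifferentiableAt ℝ (chartForm Ω x) (τ (extChartAt (𝓡 6) x₀ x)) := by
    rw [hτx]
    exact differentiableAt_chartForm hΩ hxx
  have hτ : ContDiffAt ℝ ∞ τ (extChartAt (𝓡 6) x₀ x) :=
    (contMDiffAt_iff_contDiffAt_comp_symm hx).1 (contMDiffAt_extChartAt' hxx)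
  rw [heq.extDeriv_eq, extDeriv_pullback hω hτ ?_, hτx, extDeriv_chartForm_self_eq_zero h]
  · ext u; rfl
  · rw [minSmoothness_of_isRCLikeNormedField]
    exact WithTop.coe_le_coe.2 (le_top : (2 : ℕ∞) ≤ ⊤)

lemma extDeriv_chartForm_apply {Ω : FormField M 3} (hΩ : IsSmoothForm Ω)
    (hx : x ∈ (chartAt R6 x₀).source) (v u₁ u₂ u₃ : R6) :
    extDeriv (chartForm Ω x₀) (extChartAt (𝓡 6) x₀ x) ![v, u₁, u₂, u₃] =
      fderiv ℝ (coordForm Ω x₀) (extChartAt (𝓡 6) x₀ x) v u₁ u₂ u₃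
      - fderiv ℝ (coordForm Ω x₀) (extChartAt (𝓡 6) x₀ x) u₁ v u₂ u₃
      + fderiv ℝ (coordForm Ω x₀) (extChartAt (𝓡 6) x₀ x) u₂ v u₁ u₃
      - fderiv ℝ (coordForm Ω x₀) (extChartAt (𝓡 6) x₀ x) u₃ v u₁ u₂ :=
  extDeriv_apply_cons (differentiableAt_chartForm hΩ hx) v u₁ u₂ u₃

end CoordinateForms

/-! ### Extending constant coordinate fields; the Nijenhuis tensor in coordinates -/

section Extension

variable {M : Type*} [TopologicalSpace M] [ChartedSpace R6 M] [IsManifold (𝓡 6) ∞ M] [T2Space M]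
  {x₀ x : M}

/-- Constant vector fields in a chart extend to smooth vector fields on the manifold. -/
lemma exists_isSmoothVField_coordVField_eq (hx : x ∈ (chartAt R6 x₀).source) (u : R6) :
    ∃ X : VField M, IsSmoothVField X ∧
      coordVField x₀ X =ᶠ[nhds (extChartAt (𝓡 6) x₀ x)] fun _ ↦ u := by
  obtain ⟨f, -, hf⟩ := (SmoothBumpFunction.nhds_basis_tsupport (I := 𝓡 6) x).mem_iff.1
    (source_mem_nhds hx)
  refine ⟨fun z ↦ f z • ofCoord x₀ z u, ?_, ?_⟩
  · refine ContMDiffOn.smul_section_of_tsupport (s := fun z ↦ ofCoord x₀ z u)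
      f.contMDiff.contMDiffOn (chartAt R6 x₀).open_source hf fun z hz ↦ ?_
    refine ((contMDiffAt_iff_coordVField hz).2 ?_).contMDiffWithinAt
    have : coordVField x₀ (fun z ↦ ofCoord x₀ z u) =ᶠ[nhds (extChartAt (𝓡 6) x₀ z)]
        fun _ ↦ u := by
      filter_upwards [(isOpen_target x₀).mem_nhds (mem_target hz)] with y hy
      obtain ⟨x', hx', rfl⟩ := exists_eq_of_mem_target hy
      rw [coordVField_apply hx', toCoord_ofCoord hx']
    exact contDiffAt_const.congr_of_eventuallyEq this
  · have h1 : ∀ᶠ y in nhds (extChartAt (𝓡 6) x₀ x), f ((extChartAt (𝓡 6) x₀).symm y) = 1 := by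
      have hc : ContinuousAt (extChartAt (𝓡 6) x₀).symm (extChartAt (𝓡 6) x₀ x) :=
        continuousAt_extChartAt_symm'' (mem_target hx)
      have := f.eventuallyEq_one
      refine hc.eventually (p := fun z ↦ f z = 1) ?_
      rwa [symm_extChartAt hx]
    filter_upwards [(isOpen_target x₀).mem_nhds (mem_target hx), h1] with y hy h
    obtain ⟨x', hx', rfl⟩ := exists_eq_of_mem_target hy
    rw [symm_extChartAt hx'] at h
    rw [coordVField_apply hx', h, one_smul, toCoord_ofCoord hx']

/-- Vanishing of the Nijenhuis tensor, in coordinates. -/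
lemma IsIntegrableACS.coord {J : EndField M} (hJ : IsAlmostComplexStructure J)
    (h : IsIntegrableACS J) (hx : x ∈ (chartAt R6 x₀).source) (u v : R6) :
    fderiv ℝ (coordEnd J x₀) (extChartAt (𝓡 6) x₀ x)
        (coordEnd J x₀ (extChartAt (𝓡 6) x₀ x) u) v
      - fderiv ℝ (coordEnd J x₀) (extChartAt (𝓡 6) x₀ x)
        (coordEnd J x₀ (extChartAt (𝓡 6) x₀ x) v) u
      + coordEnd J x₀ (extChartAt (𝓡 6) x₀ x)
        (fderiv ℝ (coordEnd J x₀) (extChartAt (𝓡 6) x₀ x) v u)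
      - coordEnd J x₀ (extChartAt (𝓡 6) x₀ x)
        (fderiv ℝ (coordEnd J x₀) (extChartAt (𝓡 6) x₀ x) u v) = 0 := by
  -- For fields constant in the chart near `x`, the brackets involve only derivatives of `J`.
  obtain ⟨X, hX, hXu⟩ := exists_isSmoothVField_coordVField_eq hx u
  obtain ⟨Y, hY, hYv⟩ := exists_isSmoothVField_coordVField_eq hx v
  set p := extChartAt (𝓡 6) x₀ x with hp
  set A := coordEnd J x₀ with hA
  have hAd : DifferentiableAt ℝ A p :=
    ((contDiffOn_coordEnd hJ x₀).contDiffAt ((isOpen_target x₀).mem_nhds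
      (mem_target hx))).differentiableAt (by simp)
  have hJe : ∀ {Z : VField M} {w : R6}, (coordVField x₀ Z =ᶠ[nhds p] fun _ ↦ w) →
      coordVField x₀ (fun z ↦ J z (Z z)) =ᶠ[nhds p] fun q ↦ A q w := by
    intro Z w hZ
    filter_upwards [hZ, (isOpen_target x₀).mem_nhds (mem_target hx)] with q hq hq'
    rw [coordVField_end J Z hq', hq]
  have hfd : ∀ w a : R6, fderiv ℝ (fun q ↦ A q w) p a = fderiv ℝ A p a w := fun w a ↦ by
    have := hAd.hasFDerivAt.clm_apply (hasFDerivAt_const w p)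
    rw [this.fderiv]; simp
  have d := fun {Z : VField M} (hZ : IsSmoothVField Z) ↦ hZ.mdifferentiableAt x
  have b1 := toCoord_mlieBracket hx (d (hX.end_apply hJ)) (d (hY.end_apply hJ))
  have b2 := toCoord_mlieBracket hx (d (hX.end_apply hJ)) (d hY)
  have b3 := toCoord_mlieBracket hx (d hX) (d (hY.end_apply hJ))
  have b4 := toCoord_mlieBracket hx (d hX) (d hY)
  rw [Filter.EventuallyEq.lieBracket_vectorField_eq (hJe hXu) (hJe hYv)] at b1
  rw [Filter.EventuallyEq.lieBracket_vectorField_eq (hJe hXu) hYv] at b2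
  rw [Filter.EventuallyEq.lieBracket_vectorField_eq hXu (hJe hYv)] at b3
  rw [Filter.EventuallyEq.lieBracket_vectorField_eq hXu hYv] at b4
  simp only [VectorField.lieBracket, hfd, fderiv_fun_const] at b1 b2 b3 b4
  have hAe : ∀ w, coordEnd J x₀ (extChartAt (𝓡 6) x₀ x) w = A p w := fun _ ↦ rfl
  have key := congrArg (toCoord x₀ x) (h X Y hX hY x)
  simp only [nijenhuis, map_sub, map_zero, ← coordEnd_toCoord J hx, hAe, b1, b2, b3, b4] at key
  simpa [sub_eq_add_neg, add_assoc] using key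

end Extension

/-! ### Connections given by Christoffel symbols in a chart -/

section LocalConnection

variable {M : Type*} [TopologicalSpace M] [ChartedSpace R6 M] [IsManifold (𝓡 6) ∞ M]

/-- The connection with Christoffel symbols `Γ` in the chart at `x₀`. -/
def chartConnection (x₀ : M) (Γ : R6 → R6 →L[ℝ] R6 →L[ℝ] R6) (X : VField M) (x : M) :
    TangentSpace (𝓡 6) x →L[ℝ] TangentSpace (𝓡 6) x :=
  (ofCoord x₀ x).comp ((fderiv ℝ (coordVField x₀ X) (extChartAt (𝓡 6) x₀ x) +
    Γ (extChartAt (𝓡 6) x₀ x) (toCoord x₀ x (X x))).comp (toCoord x₀ x))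

variable {x₀ x : M} {Γ : R6 → R6 →L[ℝ] R6 →L[ℝ] R6}

lemma toCoord_chartConnection (hx : x ∈ (chartAt R6 x₀).source) (X : VField M)
    (v : TangentSpace (𝓡 6) x) :
    toCoord x₀ x (chartConnection x₀ Γ X x v) =
      fderiv ℝ (coordVField x₀ X) (extChartAt (𝓡 6) x₀ x) (toCoord x₀ x v) +
        Γ (extChartAt (𝓡 6) x₀ x) (toCoord x₀ x (X x)) (toCoord x₀ x v) :=
  toCoord_ofCoord hx _

lemma chartConnection_add (hx : x ∈ (chartAt R6 x₀).source) {X Y : VField M}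
    (hX : MDifferentiableAt (𝓡 6) (𝓡 6).tangent (fun x ↦ (⟨x, X x⟩ : TangentBundle (𝓡 6) M)) x)
    (hY : MDifferentiableAt (𝓡 6) (𝓡 6).tangent (fun x ↦ (⟨x, Y x⟩ : TangentBundle (𝓡 6) M)) x) :
    chartConnection x₀ Γ (X + Y) x = chartConnection x₀ Γ X x + chartConnection x₀ Γ Y x := by
  ext1 v
  apply toCoord_injective hx
  have h : coordVField x₀ (X + Y) = coordVField x₀ X + coordVField x₀ Y := by
    ext1 y; exact map_add (toCoord x₀ _) _ _
  have h2 : toCoord x₀ x ((X + Y) x) = toCoord x₀ x (X x) + toCoord x₀ x (Y x) :=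
    map_add (toCoord x₀ x) _ _
  have h3 : toCoord x₀ x ((chartConnection x₀ Γ X x + chartConnection x₀ Γ Y x) v) =
      toCoord x₀ x (chartConnection x₀ Γ X x v) + toCoord x₀ x (chartConnection x₀ Γ Y x v) :=
    map_add (toCoord x₀ x) _ _
  rw [h3, toCoord_chartConnection hx, toCoord_chartConnection hx, toCoord_chartConnection hx, h,
    h2, fderiv_add ((mdifferentiableAt_iff_coordVField hx).1 hX)
      ((mdifferentiableAt_iff_coordVField hx).1 hY), map_add]
  simp only [add_apply]
  abel

lemma chartConnection_smul (hx : x ∈ (chartAt R6 x₀).source) {X : VField M} {g : M → ℝ}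
    (hX : MDifferentiableAt (𝓡 6) (𝓡 6).tangent (fun x ↦ (⟨x, X x⟩ : TangentBundle (𝓡 6) M)) x)
    (hg : MDifferentiableAt (𝓡 6) 𝓘(ℝ, ℝ) g x) :
    chartConnection x₀ Γ (g • X) x =
      g x • chartConnection x₀ Γ X x + (mvfderiv (𝓡 6) g x).smulRight (X x) := by
  ext1 v
  apply toCoord_injective hx
  have h : coordVField x₀ (g • X) =
      fun y ↦ (g ∘ (extChartAt (𝓡 6) x₀).symm) y • coordVField x₀ X y := by
    ext1 y; exact map_smul (toCoord x₀ _) _ _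
  have h2 : toCoord x₀ x ((g • X) x) = g x • toCoord x₀ x (X x) :=
    map_smul (toCoord x₀ x) _ _
  have h3 : toCoord x₀ x ((g x • chartConnection x₀ Γ X x +
        (mvfderiv (𝓡 6) g x).smulRight (X x)) v) =
      g x • toCoord x₀ x (chartConnection x₀ Γ X x v) +
        mvfderiv (𝓡 6) g x v • toCoord x₀ x (X x) := by
    rw [← map_smul (toCoord x₀ x), ← map_smul (toCoord x₀ x), ← map_add (toCoord x₀ x)]
    rfl
  rw [h3, toCoord_chartConnection hx, toCoord_chartConnection hx, h, h2,
    fderiv_fun_smul ((mdifferentiableAt_iff_differentiableAt_comp_symm hx).1 hg)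
      ((mdifferentiableAt_iff_coordVField hx).1 hX), map_smul,
    mvfderiv_eq_fderiv_comp_symm hx hg, coordVField_apply hx]
  simp only [add_apply, smul_apply,
    ContinuousLinearMap.smulRight_apply, Function.comp_apply, symm_extChartAt hx, smul_add]
  abel

lemma chartConnection_torsion (hx : x ∈ (chartAt R6 x₀).source) {X Y : VField M}
    (hΓ : ∀ u v, Γ (extChartAt (𝓡 6) x₀ x) u v = Γ (extChartAt (𝓡 6) x₀ x) v u)
    (hX : MDifferentiableAt (𝓡 6) (𝓡 6).tangent (fun x ↦ (⟨x, X x⟩ : TangentBundle (𝓡 6) M)) x)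
    (hY : MDifferentiableAt (𝓡 6) (𝓡 6).tangent (fun x ↦ (⟨x, Y x⟩ : TangentBundle (𝓡 6) M)) x) :
    chartConnection x₀ Γ Y x (X x) - chartConnection x₀ Γ X x (Y x) =
      VectorField.mlieBracket (𝓡 6) X Y x := by
  apply toCoord_injective hx
  rw [map_sub, toCoord_mlieBracket hx hX hY, toCoord_chartConnection hx,
    toCoord_chartConnection hx, hΓ, VectorField.lieBracket, coordVField_apply hx,
    coordVField_apply hx]
  abel

lemma contMDiffAt_chartConnection (hx : x ∈ (chartAt R6 x₀).source)
    (hΓ : ContDiffAt ℝ ∞ Γ (extChartAt (𝓡 6) x₀ x)) {X : VField M}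
    (hX : ContMDiffAt (𝓡 6) (𝓡 6).tangent ∞ (fun x ↦ (⟨x, X x⟩ : TangentBundle (𝓡 6) M)) x) :
    ContMDiffAt (𝓡 6) ((𝓡 6).prod 𝓘(ℝ, R6 →L[ℝ] R6)) ∞
      (fun x => (⟨x, chartConnection x₀ Γ X x⟩ : TotalSpace (R6 →L[ℝ] R6)
        (fun x : M => TangentSpace (𝓡 6) x →L[ℝ] TangentSpace (𝓡 6) x))) x := by
  rw [contMDiffAt_iff_coordEnd hx]
  have h1 := (contMDiffAt_iff_coordVField hx).1 hX
  have h2 : ContDiffAt ℝ ∞ (fun y ↦ fderiv ℝ (coordVField x₀ X) y + Γ y (coordVField x₀ X y))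
      (extChartAt (𝓡 6) x₀ x) :=
    (h1.fderiv_right (m := ∞) (by simp)).add (hΓ.clm_apply h1)
  refine h2.congr_of_eventuallyEq ?_
  filter_upwards [(isOpen_target x₀).mem_nhds (mem_target hx)] with y hy
  obtain ⟨z, hz, rfl⟩ := exists_eq_of_mem_target hy
  ext1 u
  rw [coordEnd_apply _ hz, toCoord_chartConnection hz, toCoord_ofCoord hz, coordVField_apply hz]
  rfl

/-- The derivative of the evaluation of a 3-form on three vector fields, in coordinates. -/
lemma mvfderiv_form_apply {Ω : FormField M 3} (hΩ : IsSmoothForm Ω)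
    (hx : x ∈ (chartAt R6 x₀).source) {X₁ X₂ X₃ : VField M}
    (hX₁ : DifferentiableAt ℝ (coordVField x₀ X₁) (extChartAt (𝓡 6) x₀ x))
    (hX₂ : DifferentiableAt ℝ (coordVField x₀ X₂) (extChartAt (𝓡 6) x₀ x))
    (hX₃ : DifferentiableAt ℝ (coordVField x₀ X₃) (extChartAt (𝓡 6) x₀ x))
    (v : TangentSpace (𝓡 6) x) :
    mvfderiv (𝓡 6) (fun z => Ω z ![X₁ z, X₂ z, X₃ z]) x v =
      fderiv ℝ (coordForm Ω x₀) (extChartAt (𝓡 6) x₀ x) (toCoord x₀ x v)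
        (toCoord x₀ x (X₁ x)) (toCoord x₀ x (X₂ x)) (toCoord x₀ x (X₃ x))
      + coordForm Ω x₀ (extChartAt (𝓡 6) x₀ x)
        (fderiv ℝ (coordVField x₀ X₁) (extChartAt (𝓡 6) x₀ x) (toCoord x₀ x v))
        (toCoord x₀ x (X₂ x)) (toCoord x₀ x (X₃ x))
      + coordForm Ω x₀ (extChartAt (𝓡 6) x₀ x) (toCoord x₀ x (X₁ x))
        (fderiv ℝ (coordVField x₀ X₂) (extChartAt (𝓡 6) x₀ x) (toCoord x₀ x v))
        (toCoord x₀ x (X₃ x))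
      + coordForm Ω x₀ (extChartAt (𝓡 6) x₀ x) (toCoord x₀ x (X₁ x)) (toCoord x₀ x (X₂ x))
        (fderiv ℝ (coordVField x₀ X₃) (extChartAt (𝓡 6) x₀ x) (toCoord x₀ x v)) := by
  have hW : DifferentiableAt ℝ (coordForm Ω x₀) (extChartAt (𝓡 6) x₀ x) :=
    ((contDiffOn_coordForm hΩ x₀).contDiffAt ((isOpen_target x₀).mem_nhds
      (mem_target hx))).differentiableAt (by simp)
  have h := ((hW.hasFDerivAt.clm_apply hX₁.hasFDerivAt).clm_apply hX₂.hasFDerivAt).clm_apply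
    hX₃.hasFDerivAt
  have heq : ((fun z => Ω z ![X₁ z, X₂ z, X₃ z]) ∘ (extChartAt (𝓡 6) x₀).symm)
      =ᶠ[nhds (extChartAt (𝓡 6) x₀ x)] fun y ↦ coordForm Ω x₀ y (coordVField x₀ X₁ y)
        (coordVField x₀ X₂ y) (coordVField x₀ X₃ y) := by
    filter_upwards [(isOpen_target x₀).mem_nhds (mem_target hx)] with y hy
    obtain ⟨z, hz, rfl⟩ := exists_eq_of_mem_target hy
    rw [coordVField_apply hz, coordVField_apply hz, coordVField_apply hz, coordForm_toCoord Ω hz,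
      Function.comp_apply, symm_extChartAt hz]
  have h' := h.congr_of_eventuallyEq heq
  rw [mvfderiv_eq_fderiv_comp_symm hx
    ((mdifferentiableAt_iff_differentiableAt_comp_symm hx).2 h'.differentiableAt), h'.fderiv]
  simp only [coordVField_apply hx, add_apply, ContinuousLinearMap.comp_apply,
    ContinuousLinearMap.flip_apply]
  ring

/-- By the product rule the derivatives of the three fields occur on both sides, leaving `hpar`.
Symmetry of `Γ` is used because `chartConnection` puts the field in its first slot and `hpar` the
direction. -/
lemma chartConnection_parallel {Ω : FormField M 3} (hΩ : IsSmoothForm Ω)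
    (hx : x ∈ (chartAt R6 x₀).source)
    (hΓ : ∀ u v, Γ (extChartAt (𝓡 6) x₀ x) u v = Γ (extChartAt (𝓡 6) x₀ x) v u)
    (hpar : ∀ v u₁ u₂ u₃, fderiv ℝ (coordForm Ω x₀) (extChartAt (𝓡 6) x₀ x) v u₁ u₂ u₃ =
      coordForm Ω x₀ (extChartAt (𝓡 6) x₀ x) (Γ (extChartAt (𝓡 6) x₀ x) v u₁) u₂ u₃
      + coordForm Ω x₀ (extChartAt (𝓡 6) x₀ x) u₁ (Γ (extChartAt (𝓡 6) x₀ x) v u₂) u₃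
      + coordForm Ω x₀ (extChartAt (𝓡 6) x₀ x) u₁ u₂ (Γ (extChartAt (𝓡 6) x₀ x) v u₃))
    {X₁ X₂ X₃ : VField M} (hX₁ : IsSmoothVField X₁) (hX₂ : IsSmoothVField X₂)
    (hX₃ : IsSmoothVField X₃) (v : TangentSpace (𝓡 6) x) :
    mvfderiv (𝓡 6) (fun z => Ω z ![X₁ z, X₂ z, X₃ z]) x v =
      Ω x ![chartConnection x₀ Γ X₁ x v, X₂ x, X₃ x]
      + Ω x ![X₁ x, chartConnection x₀ Γ X₂ x v, X₃ x]
      + Ω x ![X₁ x, X₂ x, chartConnection x₀ Γ X₃ x v] := by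
  have d := fun {Z : VField M} (hZ : IsSmoothVField Z) ↦
    (mdifferentiableAt_iff_coordVField hx).1 (hZ.mdifferentiableAt x)
  rw [mvfderiv_form_apply hΩ hx (d hX₁) (d hX₂) (d hX₃), ← coordForm_toCoord Ω hx,
    ← coordForm_toCoord Ω hx, ← coordForm_toCoord Ω hx, toCoord_chartConnection hx,
    toCoord_chartConnection hx, toCoord_chartConnection hx, hpar, hΓ _ (toCoord x₀ x v),
    hΓ _ (toCoord x₀ x v), hΓ _ (toCoord x₀ x v)]
  simp only [map_add, add_apply]
  ring

end LocalConnection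

/-! ### Sufficiency: gluing the local connections -/

section Existence

variable {M : Type*} [TopologicalSpace M] [ChartedSpace R6 M] [IsManifold (𝓡 6) ∞ M] [T2Space M]

lemma exists_chart_christoffel {Ω : FormField M 3} (hΩ : IsSmoothForm Ω)
    (hΔ : ∀ x : M, formDelta (Ω x) = {0}) {J : EndField M} (hJ : IsAlmostComplexStructure J)
    (hpure : ∀ x : M, IsPureForm (Ω x) (J x)) (hd : ∀ x : M, mextDeriv Ω x = 0)
    (hN : IsIntegrableACS J) (x₀ : M) :
    ∃ V : Set M, IsOpen V ∧ x₀ ∈ V ∧ V ⊆ (chartAt R6 x₀).source ∧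
      ∃ Γ : R6 → R6 →L[ℝ] R6 →L[ℝ] R6, ∀ x ∈ V,
        ContDiffAt ℝ ∞ Γ (extChartAt (𝓡 6) x₀ x) ∧
        (∀ u v, Γ (extChartAt (𝓡 6) x₀ x) u v = Γ (extChartAt (𝓡 6) x₀ x) v u) ∧
        ∀ v u₁ u₂ u₃, fderiv ℝ (coordForm Ω x₀) (extChartAt (𝓡 6) x₀ x) v u₁ u₂ u₃ =
          coordForm Ω x₀ (extChartAt (𝓡 6) x₀ x) (Γ (extChartAt (𝓡 6) x₀ x) v u₁) u₂ u₃
          + coordForm Ω x₀ (extChartAt (𝓡 6) x₀ x) u₁ (Γ (extChartAt (𝓡 6) x₀ x) v u₂) u₃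
          + coordForm Ω x₀ (extChartAt (𝓡 6) x₀ x) u₁ u₂
              (Γ (extChartAt (𝓡 6) x₀ x) v u₃) := by
  have hx₀ : x₀ ∈ (chartAt R6 x₀).source := mem_chart_source R6 x₀
  obtain ⟨u₁, u₂, u₃, h0⟩ := exists_coordForm_ne_zero hΔ hx₀
  obtain ⟨V, hV, hpV, -, Γ, hΓ, h⟩ := exists_local_christoffel (E := R6)
    (by simp) (isOpen_target x₀) (contDiffOn_coordForm hΩ x₀) (contDiffOn_coordEnd hJ x₀)
    (fun p _ ↦ isAltTrilinear_coordForm Ω x₀ p)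
    (fun p hp u ↦ by
      obtain ⟨x, hx, rfl⟩ := exists_eq_of_mem_target hp
      exact coordEnd_coordEnd hJ hx u)
    (fun p hp u v w ↦ by
      obtain ⟨x, hx, rfl⟩ := exists_eq_of_mem_target hp
      exact coordForm_coordEnd hpure hx u v w)
    (fun p hp v u₁ u₂ u₃ ↦ by
      obtain ⟨x, hx, rfl⟩ := exists_eq_of_mem_target hp
      rw [← extDeriv_chartForm_apply hΩ hx, extDeriv_chartForm_eq_zero hΩ (hd x) hx]
      rfl)
    (fun p hp u v ↦ by
      obtain ⟨x, hx, rfl⟩ := exists_eq_of_mem_target hp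
      exact hN.coord hJ hx u v)
    (mem_target hx₀) h0
  refine ⟨(chartAt R6 x₀).source ∩ extChartAt (𝓡 6) x₀ ⁻¹' V, ?_, ⟨hx₀, hpV⟩,
    Set.inter_subset_left, Γ, fun x hx ↦ ⟨hΓ.contDiffAt (hV.mem_nhds hx.2), h _ hx.2⟩⟩
  have hc := continuousOn_extChartAt (I := 𝓡 6) x₀
  rw [extChartAt_source] at hc
  exact hc.isOpen_inter_preimage (chartAt R6 x₀).open_source hV

/-- The Leibniz rule, vanishing torsion and parallelism are affine in the connection, so they
survive combinations whose weights sum to one. -/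
theorem exists_parallel_connection [SecondCountableTopology M]
    {Ω : FormField M 3} (hΩ : IsSmoothForm Ω)
    (hΔ : ∀ x : M, formDelta (Ω x) = {0}) {J : EndField M} (hJ : IsAlmostComplexStructure J)
    (hpure : ∀ x : M, IsPureForm (Ω x) (J x)) (hd : ∀ x : M, mextDeriv Ω x = 0)
    (hN : IsIntegrableACS J) :
    ∃ cov : LinearConnection M, CovariantDerivative.ContMDiffCovariantDerivative cov ∞ ∧
      cov.torsion = 0 ∧ IsParallelForm cov Ω := by
  choose V hVo hxV hVs Γ hΓ using exists_chart_christoffel hΩ hΔ hJ hpure hd hN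
  have : LocallyCompactSpace M := ChartedSpace.locallyCompactSpace R6 M
  obtain ⟨ρ, hρ⟩ := SmoothPartitionOfUnity.exists_isSubordinate (𝓡 6) isClosed_univ V hVo
    (fun x _ ↦ Set.mem_iUnion.2 ⟨x, hxV x⟩)
  have hmem : ∀ {x i}, i ∈ ρ.finsupport x → x ∈ V i := fun {x i} hi ↦
    hρ i (subset_closure ((ρ.mem_finsupport x).1 hi))
  have hsum : ∀ x, ∑ i ∈ ρ.finsupport x, ρ i x = 1 := fun x ↦ ρ.sum_finsupport x (Set.mem_univ x)
  -- Outside `V i` the value of `chartConnection i` is meaningless, but there the weight `ρ i`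
  -- vanishes.
  let D : VField M → ∀ x : M, TangentSpace (𝓡 6) x →L[ℝ] TangentSpace (𝓡 6) x :=
    fun X x ↦ ∑ᶠ i, ρ i x • chartConnection i (Γ i) X x
  have hD : ∀ X x, D X x = ∑ i ∈ ρ.finsupport x, ρ i x • chartConnection i (Γ i) X x :=
    fun X x ↦ (ρ.sum_finsupport_smul_eq_finsum x (fun i _ ↦ chartConnection i (Γ i) X x)).symm
  have hDv : ∀ X x v, D X x v = ∑ i ∈ ρ.finsupport x, ρ i x • chartConnection i (Γ i) X x v := by
    intro X x v
    rw [hD, sum_apply]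
    rfl
  let cov : LinearConnection M :=
    { toFun := D
      isCovariantDerivativeOnUniv :=
        { add := fun {X Y x} hX hY _ ↦ by
            rw [hD, hD, hD, ← Finset.sum_add_distrib]
            refine Finset.sum_congr rfl fun i hi ↦ ?_
            rw [chartConnection_add (hVs i (hmem hi)) hX hY, smul_add]
          leibniz := fun {X g x} hX hg _ ↦ by
            -- The derivative term of the Leibniz rule carries no weight; `∑ ρ i = 1` distributes it
            -- over the summands.
            have h1 : (mvfderiv (𝓡 6) g x).smulRight (X x) =
                ∑ i ∈ ρ.finsupport x, ρ i x • (mvfderiv (𝓡 6) g x).smulRight (X x) := by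
              rw [← Finset.sum_smul, hsum, one_smul]
            rw [hD, hD, h1, Finset.smul_sum, ← Finset.sum_add_distrib]
            refine Finset.sum_congr rfl fun i hi ↦ ?_
            rw [chartConnection_smul (hVs i (hmem hi)) hX hg, smul_add, smul_comm] } }
  have hcov : ∀ X x, cov X x = D X x := fun X x ↦ rfl
  refine ⟨cov, ⟨⟨fun {X} hX ↦ ?_⟩⟩, ?_, ?_⟩
  · rw [contMDiffOn_univ] at hX ⊢
    have hX' : IsSmoothVField X := hX.of_le (by simp)
    refine ContMDiff.finsum_section_of_locallyFinite
      (t := fun i x ↦ ρ i x • chartConnection i (Γ i) X x) ?_ fun i ↦ ?_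
    · refine ρ.locallyFinite.subset fun i x hx ↦ ?_
      exact left_ne_zero_of_smul hx
    · refine ContMDiffOn.smul_section_of_tsupport (ρ i).contMDiff.contMDiffOn (hVo i) (hρ i)
        fun x hx ↦ ?_
      exact (contMDiffAt_chartConnection (hVs i hx) (hΓ i x hx).1 (hX' x)).contMDiffWithinAt
  · rw [CovariantDerivative.torsion_eq_zero_iff]
    intro X Y x hX hY
    rw [hcov, hcov, hDv, hDv, ← Finset.sum_sub_distrib]
    have : ∀ i ∈ ρ.finsupport x, ρ i x • chartConnection i (Γ i) Y x (X x) -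
        ρ i x • chartConnection i (Γ i) X x (Y x) =
        ρ i x • VectorField.mlieBracket (𝓡 6) X Y x := fun i hi ↦ by
      rw [← smul_sub, chartConnection_torsion (hVs i (hmem hi)) (hΓ i x (hmem hi)).2.1 hX hY]
    rw [Finset.sum_congr rfl this, ← Finset.sum_smul, hsum, one_smul]
  · intro X₁ X₂ X₃ hX₁ hX₂ hX₃ x v
    have alt := isAltTrilinear_alternating (Ω x)
    let L₁ : TangentSpace (𝓡 6) x →ₗ[ℝ] ℝ :=
      ⟨⟨fun w ↦ Ω x ![w, X₂ x, X₃ x], fun a b ↦ alt.add_left a b _ _⟩,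
        fun c a ↦ alt.smul_left c a _ _⟩
    let L₂ : TangentSpace (𝓡 6) x →ₗ[ℝ] ℝ :=
      ⟨⟨fun w ↦ Ω x ![X₁ x, w, X₃ x], fun a b ↦ alt.add_mid _ a b _⟩,
        fun c a ↦ alt.smul_mid c _ a _⟩
    let L₃ : TangentSpace (𝓡 6) x →ₗ[ℝ] ℝ :=
      ⟨⟨fun w ↦ Ω x ![X₁ x, X₂ x, w], fun a b ↦ alt.add_right _ _ a b⟩,
        fun c a ↦ alt.smul_right c _ _ a⟩
    have key : mvfderiv (𝓡 6) (fun z => Ω z ![X₁ z, X₂ z, X₃ z]) x v =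
        L₁ (D X₁ x v) + L₂ (D X₂ x v) + L₃ (D X₃ x v) := by
      rw [hDv, hDv, hDv, map_sum, map_sum, map_sum, ← Finset.sum_add_distrib,
        ← Finset.sum_add_distrib]
      have : ∀ i ∈ ρ.finsupport x, L₁ (ρ i x • chartConnection i (Γ i) X₁ x v) +
          L₂ (ρ i x • chartConnection i (Γ i) X₂ x v) +
          L₃ (ρ i x • chartConnection i (Γ i) X₃ x v) =
          ρ i x • mvfderiv (𝓡 6) (fun z => Ω z ![X₁ z, X₂ z, X₃ z]) x v := fun i hi ↦ by
        have hi' := hmem hi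
        rw [chartConnection_parallel hΩ (hVs i hi') (hΓ i x hi').2.1 (hΓ i x hi').2.2 hX₁ hX₂ hX₃,
          map_smul, map_smul, map_smul, smul_add, smul_add]
        rfl
      rw [Finset.sum_congr rfl this, ← Finset.sum_smul, hsum, one_smul]
    have h1 : covDerivForm cov Ω X₁ X₂ X₃ x v =
        mvfderiv (𝓡 6) (fun z => Ω z ![X₁ z, X₂ z, X₃ z]) x v - L₁ (D X₁ x v) - L₂ (D X₂ x v) -
          L₃ (D X₃ x v) := rfl
    rw [h1, key]
    ring

end Existence

/-! ### Necessity: closedness and integrability from a parallel connection -/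

section Necessity

variable {M : Type*} [TopologicalSpace M] [ChartedSpace R6 M] [IsManifold (𝓡 6) ∞ M] [T2Space M]
  {cov : LinearConnection M} {Ω : FormField M 3}

/-- For a symmetric connection the exterior derivative is the alternation of the covariant
derivative. The proof checks this at `x` on fields constant in the chart. -/
lemma mextDeriv_eq_zero_of_parallel (hΩ : IsSmoothForm Ω) (htor : cov.torsion = 0)
    (hpar : IsParallelForm cov Ω) (x : M) : mextDeriv Ω x = 0 := by
  have hx : x ∈ (chartAt R6 x).source := mem_chart_source R6 x
  choose X hX hXu using exists_isSmoothVField_coordVField_eq hx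
  set p := extChartAt (𝓡 6) x x with hp
  have hXx : ∀ u, toCoord x x (X u x) = u := fun u ↦ by
    rw [← coordVField_apply hx]; exact (hXu u).self_of_nhds
  -- These are the Christoffel symbols of `cov` at `x`. They are symmetric because constant
  -- coordinate fields commute and the torsion vanishes.
  let g : R6 → R6 → R6 := fun u v ↦ toCoord x x (cov (X v) x (X u x))
  have hg : ∀ u v, g u v = g v u := fun u v ↦ by
    have h1 := CovariantDerivative.torsion_eq_zero_iff cov |>.1 htor
      ((hX u).mdifferentiableAt x) ((hX v).mdifferentiableAt x)
    have h2 := toCoord_mlieBracket hx ((hX u).mdifferentiableAt x) ((hX v).mdifferentiableAt x)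
    rw [Filter.EventuallyEq.lieBracket_vectorField_eq (hXu u) (hXu v), ← h1, map_sub] at h2
    simp only [VectorField.lieBracket, fderiv_fun_const] at h2
    exact sub_eq_zero.1 (h2.trans (by simp))
  have hfd : ∀ u, fderiv ℝ (coordVField x (X u)) p = 0 := fun u ↦ by
    rw [(hXu u).fderiv_eq]; simp
  have hW : ∀ v u₁ u₂ u₃, fderiv ℝ (coordForm Ω x) p v u₁ u₂ u₃ =
      coordForm Ω x p (g v u₁) u₂ u₃ + coordForm Ω x p u₁ (g v u₂) u₃ +
        coordForm Ω x p u₁ u₂ (g v u₃) := by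
    intro v u₁ u₂ u₃
    have h := hpar _ _ _ (hX u₁) (hX u₂) (hX u₃) x (X v x)
    have d := fun u ↦ (mdifferentiableAt_iff_coordVField hx).1 ((hX u).mdifferentiableAt x)
    rw [covDerivForm, mvfderiv_form_apply hΩ hx (d u₁) (d u₂) (d u₃), ← coordForm_toCoord Ω hx,
      ← coordForm_toCoord Ω hx, ← coordForm_toCoord Ω hx, ← hp, hfd, hfd, hfd] at h
    simp only [hXx, zero_apply, map_zero, add_zero] at h
    linarith
  -- Each of the four derivatives expands into three terms in `g`; the twelve terms cancel in pairs.
  have key : ∀ v u₁ u₂ u₃, extDeriv (chartForm Ω x) p ![v, u₁, u₂, u₃] = 0 := by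
    intro v u₁ u₂ u₃
    have alt := isAltTrilinear_coordForm Ω x p
    have s1 : ∀ a b c, coordForm Ω x p a b c = -coordForm Ω x p b a c :=
      fun a b c ↦ alt.swap_left b a c
    have s2 : ∀ a b c, coordForm Ω x p a b c = coordForm Ω x p c a b :=
      fun a b c ↦ by rw [s1 c a b, ← alt.swap_right a c b]
    rw [extDeriv_chartForm_apply hΩ hx, ← hp, hW, hW, hW, hW, hg u₁ v, hg u₂ v, hg u₃ v, hg u₂ u₁,
      hg u₃ u₁, hg u₃ u₂, s1 u₁ (g v u₂), s2 u₁ u₂ (g v u₃), s1 v (g u₁ u₂), s2 v u₂ (g u₁ u₃),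
      s2 v u₁ (g u₂ u₃), s1 v (g u₁ u₃)]
    ring
  have h0 : extDeriv (chartForm Ω x) p = 0 := by
    ext m
    have : m = ![m 0, m 1, m 2, m 3] := by ext i; fin_cases i <;> rfl
    rw [this]
    exact key _ _ _ _
  rw [mextDeriv, ← hp, h0]
  rfl

lemma exists_isSmoothVField_eq (x : M) (v : TangentSpace (𝓡 6) x) :
    ∃ X : VField M, IsSmoothVField X ∧ X x = v := by
  have hx : x ∈ (chartAt R6 x).source := mem_chart_source R6 x
  obtain ⟨X, hX, h⟩ := exists_isSmoothVField_coordVField_eq hx (toCoord x x v)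
  refine ⟨X, hX, toCoord_injective hx ?_⟩
  rw [← coordVField_apply hx]
  exact h.self_of_nhds

/-- A connection preserving a pure 3-form of type 2 preserves the almost complex structure. -/
lemma cov_end_eq_of_parallel (hΔ : ∀ x : M, formDelta (Ω x) = {0}) {J : EndField M}
    (hJ : IsAlmostComplexStructure J) (hpure : ∀ x : M, IsPureForm (Ω x) (J x))
    (hpar : IsParallelForm cov Ω) {Z : VField M} (hZ : IsSmoothVField Z) (x : M)
    (v : TangentSpace (𝓡 6) x) : cov (fun z ↦ J z (Z z)) x v = J x (cov Z x v) := by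
  -- `B X` is `(∇_v J) X` at `x`. It stays a function of fields, so its tensoriality need not be
  -- shown.
  let B : VField M → TangentSpace (𝓡 6) x := fun X ↦
    cov (fun z ↦ J z (X z)) x v - J x (cov X x v)
  have alt := isAltTrilinear_alternating (Ω x)
  have sub₁ : ∀ a b c d, Ω x ![a - b, c, d] = Ω x ![a, c, d] - Ω x ![b, c, d] := fun a b c d ↦ by
    have := alt.add_left (a - b) b c d
    rw [sub_add_cancel] at this
    linarith
  have sub₂ : ∀ a b c d, Ω x ![c, a - b, d] = Ω x ![c, a, d] - Ω x ![c, b, d] := fun a b c d ↦ by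
    have := alt.add_mid c (a - b) b d
    rw [sub_add_cancel] at this
    linarith
  -- Differentiating the purity equation along `v` with `∇Ω = 0` makes `Ω` pure with respect to `B`
  -- as well.
  have e1 : ∀ {X Y W : VField M}, IsSmoothVField X → IsSmoothVField Y → IsSmoothVField W →
      Ω x ![B X, Y x, W x] = Ω x ![X x, B Y, W x] := by
    intro X Y W hX hY hW
    have h1 := hpar _ _ _ (hX.end_apply hJ) hY hW x v
    have h2 := hpar _ _ _ hX (hY.end_apply hJ) hW x v
    have h3 : (fun z => Ω z ![J z (X z), Y z, W z]) = fun z => Ω z ![X z, J z (Y z), W z] := by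
      ext1 z; exact (hpure z _ _ _).1
    rw [covDerivForm] at h1 h2
    rw [h3, (hpure x (X x) (cov Y x v) (W x)).1, (hpure x (X x) (Y x) (cov W x v)).1] at h1
    rw [← (hpure x (cov X x v) (Y x) (W x)).1] at h2
    rw [sub₁, sub₂]
    linarith
  have e2 : ∀ {X Y W : VField M}, IsSmoothVField X → IsSmoothVField Y → IsSmoothVField W →
      Ω x ![B X, Y x, W x] = Ω x ![X x, Y x, B W] := by
    intro X Y W hX hY hW
    have := e1 hX hW hY
    have h1 := alt.swap_right (B X) (Y x) (W x)
    have h2 := alt.swap_right (X x) (Y x) (B W)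
    linarith
  -- `∇_v J` anticommutes with `J`, from `J² = -1`.
  have hB : B (fun z ↦ J z (Z z)) = -J x (B Z) := by
    have h1 : (fun z ↦ J z (J z (Z z))) = (-1 : ℝ) • Z := by
      ext1 z
      exact (hJ.sq z (Z z)).trans (neg_one_smul ℝ (Z z)).symm
    have h2 : cov ((-1 : ℝ) • Z) x = (-1 : ℝ) • cov Z x :=
      cov.isCovariantDerivativeOnUniv.smul_const (-1) (hZ.mdifferentiableAt x)
    have h3 : cov (fun z ↦ J z (J z (Z z))) x v = -cov Z x v := by
      rw [h1, h2]
      exact neg_one_smul ℝ (cov Z x v)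
    change cov (fun z ↦ J z (J z (Z z))) x v - J x (cov (fun z ↦ J z (Z z)) x v) =
      -J x (cov (fun z ↦ J z (Z z)) x v - J x (cov Z x v))
    rw [h3, map_sub, hJ.sq]
    abel
  -- Both `B` and `J` can be moved between slots. Comparing the two orders, anticommutation gives
  -- `Ω(X, Y, J B Z) = -Ω(X, Y, J B Z)`; non-degeneracy then applies.
  have hzero : J x (B Z) = 0 := by
    refine eq_zero_of_formDelta (hΔ x) fun a b ↦ ?_
    obtain ⟨X, hX, rfl⟩ := exists_isSmoothVField_eq x a
    obtain ⟨Y, hY, rfl⟩ := exists_isSmoothVField_eq x b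
    have h1 := e2 hX hY (hZ.end_apply hJ)
    have h2 := e2 hX (hY.end_apply hJ) hZ
    have h3 := (hpure x (B X) (Y x) (Z x)).2
    have h4 := (hpure x (X x) (Y x) (B Z)).2
    have h5 : Ω x ![X x, Y x, -J x (B Z)] = -Ω x ![X x, Y x, J x (B Z)] := by
      have := alt.smul_right (-1) (X x) (Y x) (J x (B Z))
      rw [neg_one_smul] at this
      linarith
    rw [hB, h5] at h1
    have h6 := alt.swap_right (X x) (Y x) (J x (B Z))
    have h7 := alt.swap_left (X x) (J x (B Z)) (Y x)
    linarith
  have h := hJ.sq x (B Z)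
  rw [hzero, map_zero] at h
  exact sub_eq_zero.1 (neg_eq_zero.1 h.symm)

/-- Vanishing torsion rewrites each bracket as a difference of covariant derivatives. Once `J`
commutes with `∇`, all terms of `N_J` cancel. -/
lemma isIntegrableACS_of_parallel (hΔ : ∀ x : M, formDelta (Ω x) = {0}) {J : EndField M}
    (hJ : IsAlmostComplexStructure J) (hpure : ∀ x : M, IsPureForm (Ω x) (J x))
    (htor : cov.torsion = 0) (hpar : IsParallelForm cov Ω) : IsIntegrableACS J := by
  intro X Y hX hY x
  have t := fun {A B : VField M} (hA : IsSmoothVField A) (hB : IsSmoothVField B) ↦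
    CovariantDerivative.torsion_eq_zero_iff cov |>.1 htor
      (hA.mdifferentiableAt x) (hB.mdifferentiableAt x)
  have c := fun {Z : VField M} (hZ : IsSmoothVField Z) ↦
    cov_end_eq_of_parallel hΔ hJ hpure hpar hZ x
  rw [nijenhuis, ← t (hX.end_apply hJ) (hY.end_apply hJ), ← t (hX.end_apply hJ) hY,
    ← t hX (hY.end_apply hJ), ← t hX hY, c hX, c hX, c hY, c hY]
  simp only [map_sub, hJ.sq]
  abel

end Necessity

theorem mainTheorem2 {M : Type*} [TopologicalSpace M] [ChartedSpace R6 M]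
    [IsManifold (𝓡 6) ∞ M] [T2Space M] [SecondCountableTopology M]
    (Ω : FormField M 3) (hΩ : IsSmoothForm Ω)
    (hΔ : ∀ x : M, formDelta (Ω x) = {0})
    (J : EndField M) (hJ : IsAlmostComplexStructure J)
    (hpure : ∀ x : M, IsPureForm (Ω x) (J x)) :
    (∃ cov : LinearConnection M, CovariantDerivative.ContMDiffCovariantDerivative cov ∞ ∧
        cov.torsion = 0 ∧ IsParallelForm cov Ω) ↔
      (∀ x : M, mextDeriv Ω x = 0) ∧ IsIntegrableACS J :=
  ⟨fun ⟨_, _, htor, hpar⟩ ↦ ⟨mextDeriv_eq_zero_of_parallel hΩ htor hpar,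
    isIntegrableACS_of_parallel hΔ hJ hpure htor hpar⟩,
    fun ⟨hd, hN⟩ ↦ exists_parallel_connection hΩ hΔ hJ hpure hd hN⟩

end
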